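/- Conventions. Let $(M,g)$ be a (finite-dimensional, Hausdorff, smooth) Riemannian manifold and $T$ a smooth 3-form on $M$. Write $\nabla^g$ for the Levi-Civita connection, and let $\nabla^T$ be the metric connection with totally skew-symmetric torsion $T$, $g(\nabla^T_XY,Z)=g(\nabla^g_XY,Z)+\tfrac12T(X,Y,Z)$. For a 1-form $\eta$ with metric dual $\xi$, put $d^T\eta=d\eta-T(\xi,\cdot,\cdot)$, where $d\eta(X,Y)=X\eta(Y)-Y\eta(X)-\eta([X,Y])$. A Hermitian manifold $(N,h,J)$ ($J^2=-1$, $h(JX,JY)=h(X,Y)$, vanishing Nijenhuis tensor of $J$) with a 3-form $B$ is Kähler with torsion (KT), with Bismut torsion $B$, if the connection $\nabla^B$ of $h$ with totally skew-symmetric torsion $B$ satisfies $\nabla^BJ=0$. $(M,g,T)$ is a Sasaki with torsion (ST) manifold if its metric cone $C(M)=(M\times\mathbb R_{>0},\ \bar g=dr^2+r^2g)$ admits a complex structure $J$ making it KT with Bismut torsion $B=r^2T$. The triple $(\xi,\eta,\Phi)$ associated with such a $J$ is given, on $M=M\times\{1\}$, by $\xi=J(r\partial_r)$, $\eta=g(\xi,\cdot)$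 and $\Phi(X)=$ the component of $J(X)$ tangent to $M$. A vector field $\xi$, 1-form $\eta$ and (1,1)-tensor field $\Phi$ (all smooth) form, with $g$, an almost contact metric structure if $\eta(\xi)=1$, $\Phi^2=-\mathrm{id}+\eta\otimes\xi$ and $g(\Phi X,\Phi Y)=g(X,Y)-\eta(X)\eta(Y)$; put $\omega(X,Y)=g(\Phi X,Y)$. Then $(M,g,\xi,\eta,\Phi,T)$ is T-contact metric if moreover $d^T\eta=2\omega$, $\iota_\xi d\omega=0$ and $$T(X,Y,Z)=T(X,\Phi Y,\Phi Z)+T(\Phi X,Y,\Phi Z)+T(\Phi X,\Phi Y,Z),$$ and TK-contact metric if in addition $\xi$ is a Killing vector field. Put $\mathcal D=\ker\eta$. The almost CR structure $(\mathcal D,\Phi|_{\mathcal D})$ is integrable if for all sections $X,Y$ of $\mathcal D$ the field $[\Phi X,Y]+[X,\Phi Y]$ is a section of $\mathcal D$ and $[\Phi X,\Phi Y]-[X,Y]-\Phi([\Phi X,Y]+[X,\Phi Y])=0$. Proposition 2.5. $(M,g,T)$ is an ST manifold if and only if there is a triple $(\xi,\eta,\Phi)$ on $M$ such that 1. $(M,g,\xi,\eta,\Phi,T)$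 is a TK-contact metric manifold, 2. the almost CR structure $(\mathcal D,\Phi|_{\mathcal D})$ is integrable, and 3. $T|_{\mathcal D}$ is given by a Bismut torsion: $T(X,Y,Z)=d\omega(\Phi X,\Phi Y,\Phi Z)$ for all sections $X,Y,Z$ of $\mathcal D$. More precisely, a triple $(\xi,\eta,\Phi)$ on $M$ is associated with an ST structure of $(M,g,T)$ (that is, with a complex structure $J$ on $C(M)$ as above) if and only if it satisfies 1, 2 and 3. -/

import Mathlib

open scoped Manifold ContDiff
open VectorField

noncomputable section

namespace STGeometry

section General

variable {E : Type*} [NormedAddCommGroup E] [NormedSpace ℝ E]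
  {H : Type*} [TopologicalSpace H] (I : ModelWithCorners ℝ E H)
  (M : Type*) [TopologicalSpace M] [ChartedSpace H M]

/-- Vector fields, not necessarily smooth. -/
abbrev VField := ∀ x : M, TangentSpace I x

/-- Fields of linear forms. -/
abbrev OneForm := ∀ x : M, TangentSpace I x →L[ℝ] ℝ

/-- Fields of bilinear forms (metrics, and 2-forms such as fundamental forms). -/
abbrev BilinField := ∀ x : M, TangentSpace I x →L[ℝ] TangentSpace I x →L[ℝ] ℝ

/-- Fields of endomorphisms of the tangent spaces, i.e. tensor fields of type (1,1). -/
abbrev EndoField := ∀ x : M, TangentSpace I x →L[ℝ] TangentSpace I x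

/-- Fields of alternating trilinear forms. -/
abbrev ThreeForm := ∀ x : M, TangentSpace I x [⋀^Fin 3]→L[ℝ] ℝ

variable {I M}

section Smoothness

variable [IsManifold I ∞ M]

/-- A vector field is smooth if it is a smooth section of the tangent bundle. -/
def SmoothVF (X : VField I M) : Prop :=
  ContMDiff I I.tangent ∞ (fun x : M => (⟨x, X x⟩ : TangentBundle I M))

/-- A field of endomorphisms is smooth if the bundle map it induces on the tangent bundle is. -/
def SmoothEndo (A : EndoField I M) : Prop :=
  ContMDiff I.tangent I.tangent ∞
    (fun v : TangentBundle I M => (⟨v.1, A v.1 v.2⟩ : TangentBundle I M))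

/-- A 1-form is smooth if the (fibrewise linear) function it induces on the tangent bundle is. -/
def SmoothOneForm (α : OneForm I M) : Prop :=
  ContMDiff I.tangent 𝓘(ℝ, ℝ) ∞ (fun v : TangentBundle I M => α v.1 v.2)

/-- A 3-form is smooth if its values on smooth vector fields are smooth functions. -/
def SmoothThreeForm (T : ThreeForm I M) : Prop :=
  ∀ X Y Z : VField I M, SmoothVF X → SmoothVF Y → SmoothVF Z →
    ContMDiff I 𝓘(ℝ, ℝ) ∞ (fun x => T x ![X x, Y x, Z x])

end Smoothness

/-- The derivative `X f` of the function `f` along the vector field `X`, at the point `x`. -/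
def dirDeriv (X : VField I M) (f : M → ℝ) (x : M) : ℝ := mvfderiv I f x (X x)

/-- The vector field `A X`, for a field `A` of endomorphisms. -/
def app (A : EndoField I M) (X : VField I M) : VField I M := fun x => A x (X x)

/-- The exterior derivative of a 1-form,
`dα(X, Y) = X (α Y) - Y (α X) - α [X, Y]`. -/
def extDeriv₁ (α : OneForm I M) (X Y : VField I M) (x : M) : ℝ :=
  dirDeriv X (fun y => α y (Y y)) x - dirDeriv Y (fun y => α y (X y)) x
    - α x (mlieBracket I X Y x)

/-- The exterior derivative of a 2-form,
`dσ(X, Y, Z) = X σ(Y, Z) + Y σ(Z, X) + Z σ(X, Y) - σ([X, Y], Z) - σ([Y, Z], X) - σ([Z, X], Y)`. -/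
def extDeriv₂ (σ : BilinField I M) (X Y Z : VField I M) (x : M) : ℝ :=
  dirDeriv X (fun y => σ y (Y y) (Z y)) x + dirDeriv Y (fun y => σ y (Z y) (X y)) x
    + dirDeriv Z (fun y => σ y (X y) (Y y)) x
    - σ x (mlieBracket I X Y x) (Z x) - σ x (mlieBracket I Y Z x) (X x)
    - σ x (mlieBracket I Z X x) (Y x)

/-- The function `g(∇_X Y, Z)`, where `∇` is the Levi-Civita connection of the metric `g`,
given by the Koszul formula. -/
def leviCivita (g : BilinField I M) (X Y Z : VField I M) (x : M) : ℝ :=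
  (1 / 2) * (dirDeriv X (fun y => g y (Y y) (Z y)) x + dirDeriv Y (fun y => g y (X y) (Z y)) x
    - dirDeriv Z (fun y => g y (X y) (Y y)) x
    + g x (mlieBracket I X Y x) (Z x) - g x (mlieBracket I X Z x) (Y x)
    - g x (mlieBracket I Y Z x) (X x))

/-- The function `g(∇ᵀ_X Y, Z) = g(∇_X Y, Z) + T(X, Y, Z) / 2`, where `∇ᵀ` is the metric connection
whose totally skew-symmetric torsion is the 3-form `T`. -/
def torsionConnection (g : BilinField I M) (T : ThreeForm I M) (X Y Z : VField I M) (x : M) : ℝ :=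
  leviCivita g X Y Z x + (1 / 2) * T x ![X x, Y x, Z x]

/-- The fundamental 2-form `(X, Y) ↦ g(A X, Y)`. -/
def fundamentalForm (g : BilinField I M) (A : EndoField I M) : BilinField I M :=
  fun x => (g x).comp (A x)

/-- `ξ` is a Killing vector field of `g`: the Lie derivative of `g` along `ξ` vanishes. -/
def IsKilling [IsManifold I ∞ M] (g : BilinField I M) (ξ : VField I M) : Prop :=
  ∀ X Y : VField I M, SmoothVF X → SmoothVF Y → ∀ x : M,
    dirDeriv ξ (fun y => g y (X y) (Y y)) x
      - g x (mlieBracket I ξ X x) (Y x) - g x (X x) (mlieBracket I ξ Y x) = 0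

/-- `(g, J)` is a Hermitian structure: `J` is a smooth almost complex structure with vanishing
Nijenhuis tensor, and the Riemannian metric `g` is `J`-invariant. -/
structure IsHermitian [IsManifold I ∞ M] (g : BilinField I M) (J : EndoField I M) : Prop where
  smooth : SmoothEndo J
  sq : ∀ (x : M) (v : TangentSpace I x), J x (J x v) = -v
  isometric : ∀ (x : M) (v w : TangentSpace I x), g x (J x v) (J x w) = g x v w
  nijenhuis : ∀ X Y : VField I M, SmoothVF X → SmoothVF Y → ∀ x : M,
    mlieBracket I (app J X) (app J Y) x - mlieBracket I X Y x
      - J x (mlieBracket I X (app J Y) x) - J x (mlieBracket I (app J X) Y x) = 0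

/-- `(g, J, B)` is a Kähler with torsion structure, i.e. `(g, J)` is a Hermitian structure and `B`
is its Bismut torsion: the metric connection `∇ᴮ` with totally skew-symmetric torsion `B` satisfies
`∇ᴮ J = 0`. As `J` is skew-adjoint, `∇ᴮ_X (J Y) = J (∇ᴮ_X Y)` means that
`g(∇ᴮ_X (J Y), Z) = - g(∇ᴮ_X Y, J Z)` for all `Z`. -/
structure IsKahlerWithTorsion [IsManifold I ∞ M] (g : BilinField I M) (J : EndoField I M)
    (B : ThreeForm I M) : Prop where
  hermitian : IsHermitian g J
  parallel : ∀ X Y Z : VField I M, SmoothVF X → SmoothVF Y → SmoothVF Z → ∀ x : M,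
    torsionConnection g B X (app J Y) Z x = -torsionConnection g B X Y (app J Z) x

/-- `(g, ξ, η, Φ)` is an almost contact metric structure. -/
structure IsAlmostContactMetric [IsManifold I ∞ M] (g : BilinField I M) (ξ : VField I M)
    (η : OneForm I M) (Φ : EndoField I M) : Prop where
  smooth_xi : SmoothVF ξ
  smooth_eta : SmoothOneForm η
  smooth_phi : SmoothEndo Φ
  eta_xi : ∀ x : M, η x (ξ x) = 1
  phi_sq : ∀ (x : M) (v : TangentSpace I x), Φ x (Φ x v) = -v + η x v • ξ x
  metric : ∀ (x : M) (v w : TangentSpace I x), g x (Φ x v) (Φ x w) = g x v w - η x v * η x w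

/-- The torsion exterior derivative `dᵀη = dη - ∑ₐ η(eₐ) T(eₐ, -, -) = dη - T(ξ, -, -)` of a 1-form
`η`, where `(eₐ)` is an orthonormal frame and `ξ` is the vector field which is metrically dual
to `η`. -/
def torsionExtDeriv (T : ThreeForm I M) (ξ : VField I M) (η : OneForm I M) (X Y : VField I M)
    (x : M) : ℝ :=
  extDeriv₁ η X Y x - T x ![ξ x, X x, Y x]

/-- `(g, ξ, η, Φ, T)` is a T-contact metric structure: an almost contact metric structure with
`dᵀη = 2ω` and `ξ ⌟ dω = 0`, where `ω` is the fundamental 2-form, such that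
`T(X, Y, Z) = T(X, Φ Y, Φ Z) + T(Φ X, Y, Φ Z) + T(Φ X, Φ Y, Z)`.
(In an almost contact metric structure, `ξ` is metrically dual to `η`.) -/
structure IsTContactMetric [IsManifold I ∞ M] (g : BilinField I M) (ξ : VField I M)
    (η : OneForm I M) (Φ : EndoField I M) (T : ThreeForm I M) : Prop
    extends IsAlmostContactMetric g ξ η Φ where
  contact : ∀ X Y : VField I M, SmoothVF X → SmoothVF Y → ∀ x : M,
    torsionExtDeriv T ξ η X Y x = 2 * fundamentalForm g Φ x (X x) (Y x)
  interior : ∀ X Y : VField I M, SmoothVF X → SmoothVF Y → ∀ x : M,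
    extDeriv₂ (fundamentalForm g Φ) ξ X Y x = 0
  torsion : ∀ (x : M) (u v w : TangentSpace I x),
    T x ![u, v, w] = T x ![u, Φ x v, Φ x w] + T x ![Φ x u, v, Φ x w] + T x ![Φ x u, Φ x v, w]

/-- A TK-contact metric structure is a T-contact metric structure with `ξ` Killing. -/
structure IsTKContactMetric [IsManifold I ∞ M] (g : BilinField I M) (ξ : VField I M)
    (η : OneForm I M) (Φ : EndoField I M) (T : ThreeForm I M) : Prop
    extends IsTContactMetric g ξ η Φ T where
  killing : IsKilling g ξ

/-- The distribution `𝓓 = ker η`. -/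
def contactDistribution (η : OneForm I M) (x : M) : Submodule ℝ (TangentSpace I x) :=
  LinearMap.ker (η x).toLinearMap

/-- `(D, A|_D)` is an integrable almost Cauchy-Riemann structure: `A` restricts to an almost complex
structure on `D`, and, for all sections `X`, `Y` of `D`, the vector field `[A X, Y] + [X, A Y]` is
a section of `D` and the Nijenhuis tensor of `A|_D` vanishes. -/
structure IsIntegrableCR [IsManifold I ∞ M] (D : ∀ x : M, Submodule ℝ (TangentSpace I x))
    (A : EndoField I M) : Prop where
  maps_to : ∀ (x : M) (v : TangentSpace I x), v ∈ D x → A x v ∈ D x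
  sq : ∀ (x : M) (v : TangentSpace I x), v ∈ D x → A x (A x v) = -v
  bracket_mem : ∀ X Y : VField I M, SmoothVF X → SmoothVF Y → (∀ x, X x ∈ D x) →
    (∀ x, Y x ∈ D x) → ∀ x : M,
    mlieBracket I (app A X) Y x + mlieBracket I X (app A Y) x ∈ D x
  nijenhuis : ∀ X Y : VField I M, SmoothVF X → SmoothVF Y → (∀ x, X x ∈ D x) →
    (∀ x, Y x ∈ D x) → ∀ x : M,
    mlieBracket I (app A X) (app A Y) x - mlieBracket I X Y x
      - A x (mlieBracket I (app A X) Y x + mlieBracket I X (app A Y) x) = 0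

/-- The restriction of `T` to `D` is given by a Bismut torsion:
`T(X, Y, Z) = dω(A X, A Y, A Z)` for all sections `X`, `Y`, `Z` of `D`, where `ω(X, Y) = g(A X, Y)`
is the fundamental 2-form. -/
def IsBismutOn [IsManifold I ∞ M] (g : BilinField I M)
    (D : ∀ x : M, Submodule ℝ (TangentSpace I x)) (A : EndoField I M) (T : ThreeForm I M) : Prop :=
  ∀ X Y Z : VField I M, SmoothVF X → SmoothVF Y → SmoothVF Z →
    (∀ x, X x ∈ D x) → (∀ x, Y x ∈ D x) → (∀ x, Z x ∈ D x) → ∀ x : M,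
    T x ![X x, Y x, Z x] = extDeriv₂ (fundamentalForm g A) (app A X) (app A Y) (app A Z) x

end General

section Cone

/-- The open half-line `(0, ∞)`, as an open submanifold of `ℝ`. -/
abbrev PosReal : TopologicalSpace.Opens ℝ := ⟨Set.Ioi 0, isOpen_Ioi⟩

/-- The point `1` of the half-line. -/
def posOne : PosReal := ⟨1, Set.mem_Ioi.2 one_pos⟩

/-- The cone `C(M) = M × (0, ∞)`. -/
abbrev Cone (M : Type*) : Type _ := M × PosReal

variable {E : Type*} [NormedAddCommGroup E] [NormedSpace ℝ E]
  {M : Type*} [TopologicalSpace M] [ChartedSpace E M]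

/-- The differential at `p` of the projection `C(M) → M`. -/
def coneProj (p : Cone M) :
    TangentSpace (𝓘(ℝ, E).prod 𝓘(ℝ, ℝ)) p →L[ℝ] TangentSpace 𝓘(ℝ, E) p.1 :=
  mfderiv (𝓘(ℝ, E).prod 𝓘(ℝ, ℝ)) 𝓘(ℝ, E) (Prod.fst : Cone M → M) p

/-- The 1-form `dr` on the cone, where `r` is the projection to `(0, ∞)`. -/
def coneDr : OneForm (𝓘(ℝ, E).prod 𝓘(ℝ, ℝ)) (Cone M) :=
  fun p => mvfderiv (𝓘(ℝ, E).prod 𝓘(ℝ, ℝ)) (fun q : Cone M => (q.2 : ℝ)) p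

/-- The vector field `∂_r` on the cone. -/
def coneRadial : VField (𝓘(ℝ, E).prod 𝓘(ℝ, ℝ)) (Cone M) :=
  fun _ => ((0 : E), (1 : ℝ))

/-- The differential at `x` of the inclusion `M → C(M)`, `y ↦ (y, 1)`. -/
def coneIncl (x : M) :
    TangentSpace 𝓘(ℝ, E) x →L[ℝ] TangentSpace (𝓘(ℝ, E).prod 𝓘(ℝ, ℝ)) ((x, posOne) : Cone M) :=
  mfderiv 𝓘(ℝ, E) (𝓘(ℝ, E).prod 𝓘(ℝ, ℝ)) (fun y : M => ((y, posOne) : Cone M)) x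

/-- The cone metric `dr² + r² g`. -/
def coneMetric (g : BilinField 𝓘(ℝ, E) M) : BilinField (𝓘(ℝ, E).prod 𝓘(ℝ, ℝ)) (Cone M) :=
  fun p => (coneDr p).smulRight (coneDr p)
    + (p.2 : ℝ) ^ 2 • (ContinuousLinearMap.precomp ℝ (coneProj p)).comp ((g p.1).comp (coneProj p))

/-- The 3-form `r² T` on the cone (with `T` pulled back from `M`). -/
def coneThreeForm (T : ThreeForm 𝓘(ℝ, E) M) : ThreeForm (𝓘(ℝ, E).prod 𝓘(ℝ, ℝ)) (Cone M) :=
  fun p => (p.2 : ℝ) ^ 2 • (T p.1).compContinuousLinearMap (coneProj p)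

theorem coneProj_apply (p : Cone M) (v : TangentSpace (𝓘(ℝ, E).prod 𝓘(ℝ, ℝ)) p) :
    coneProj p v = (show E × ℝ from v).1 := by
  rw [coneProj, mfderiv_fst]; rfl

theorem mvfderiv_posReal_val (r : PosReal) (t : TangentSpace 𝓘(ℝ, ℝ) r) :
    mvfderiv 𝓘(ℝ, ℝ) (fun s : PosReal => (s : ℝ)) r t = (show ℝ from t) := by
  have hd : MDifferentiableAt 𝓘(ℝ, ℝ) 𝓘(ℝ, ℝ) (fun s : PosReal => (s : ℝ)) r :=
    (contMDiff_subtype_val (n := 1) (I := 𝓘(ℝ, ℝ))).mdifferentiable one_ne_zero r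
  have hw : writtenInExtChartAt 𝓘(ℝ, ℝ) 𝓘(ℝ, ℝ) r (fun s : PosReal => (s : ℝ))
      =ᶠ[nhds (r : ℝ)] id := by
    have h := TopologicalSpace.Opens.chartAt_subtype_val_symm_eventuallyEq (H := ℝ) PosReal (x := r)
    simp only [chartAt_self_eq, OpenPartialHomeomorph.refl_apply] at h
    filter_upwards [h] with y hy
    exact hy.symm
  have he : extChartAt 𝓘(ℝ, ℝ) r r = (r : ℝ) := rfl
  have hf : fderivWithin ℝ (writtenInExtChartAt 𝓘(ℝ, ℝ) 𝓘(ℝ, ℝ) r (fun s : PosReal => (s : ℝ)))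
      (Set.range 𝓘(ℝ, ℝ)) (extChartAt 𝓘(ℝ, ℝ) r r) = ContinuousLinearMap.id ℝ ℝ := by
    rw [he, modelWithCornersSelf_coe, Set.range_id, fderivWithin_univ, hw.fderiv_eq, fderiv_id]
  have hm : mfderiv 𝓘(ℝ, ℝ) 𝓘(ℝ, ℝ) (fun s : PosReal => (s : ℝ)) r
      = ContinuousLinearMap.id ℝ ℝ := by
    unfold mfderiv
    exact (if_pos hd).trans hf
  change (mfderiv 𝓘(ℝ, ℝ) 𝓘(ℝ, ℝ) (fun s : PosReal => (s : ℝ)) r) t = _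
  rw [hm]
  rfl

theorem coneDr_apply (p : Cone M) (v : TangentSpace (𝓘(ℝ, E).prod 𝓘(ℝ, ℝ)) p) :
    coneDr p v = (show E × ℝ from v).2 := by
  have hd : MDifferentiableAt 𝓘(ℝ, ℝ) 𝓘(ℝ, ℝ) (fun s : PosReal => (s : ℝ)) p.2 :=
    (contMDiff_subtype_val (n := 1) (I := 𝓘(ℝ, ℝ))).mdifferentiable one_ne_zero p.2
  have h := mfderiv_comp p hd (mdifferentiableAt_snd (I := 𝓘(ℝ, E)) (I' := 𝓘(ℝ, ℝ)) (x := p))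
  rw [mfderiv_snd] at h
  refine Eq.trans ?_ (mvfderiv_posReal_val p.2 (show E × ℝ from v).2)
  exact congrArg (fun L => L v) h

theorem coneIncl_apply (x : M) (v : TangentSpace 𝓘(ℝ, E) x) :
    coneIncl x v = ((show E from v, (0 : ℝ)) : E × ℝ) := by
  rw [coneIncl, mfderiv_prod_left]; rfl

theorem coneMetric_apply (g : BilinField 𝓘(ℝ, E) M) (p : Cone M)
    (v w : TangentSpace (𝓘(ℝ, E).prod 𝓘(ℝ, ℝ)) p) :
    coneMetric g p v w
      = coneDr p v * coneDr p w + (p.2 : ℝ) ^ 2 * g p.1 (coneProj p v) (coneProj p w) := rfl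

variable [IsManifold 𝓘(ℝ, E) ∞ M]

/-- `(M, g, T)` is a Sasaki with torsion (ST) manifold: its metric cone is a Kähler with torsion
manifold, for some complex structure, with Bismut torsion `r² T`. -/
def IsSasakiWithTorsion (g : BilinField 𝓘(ℝ, E) M) (T : ThreeForm 𝓘(ℝ, E) M) : Prop :=
  ∃ J : EndoField (𝓘(ℝ, E).prod 𝓘(ℝ, ℝ)) (Cone M),
    IsKahlerWithTorsion (coneMetric g) J (coneThreeForm T)

/-- `(ξ, η, Φ)` is a triple associated with the ST manifold `(M, g, T)`: for some complex
structure `J` making the cone a Kähler with torsion manifold with Bismut torsion `r² T`, after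
identifying `M` with `M × {1}`, the vector field `ξ` is `J(r ∂_r)`, the 1-form `η` is metrically
dual to `ξ`, and `Φ X` is the component of `J X` tangent to `M`. -/
def IsSTTriple (g : BilinField 𝓘(ℝ, E) M) (T : ThreeForm 𝓘(ℝ, E) M)
    (ξ : VField 𝓘(ℝ, E) M) (η : OneForm 𝓘(ℝ, E) M) (Φ : EndoField 𝓘(ℝ, E) M) : Prop :=
  ∃ J : EndoField (𝓘(ℝ, E).prod 𝓘(ℝ, ℝ)) (Cone M),
    IsKahlerWithTorsion (coneMetric g) J (coneThreeForm T) ∧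
    (∀ x : M, ξ x = coneProj (x, posOne) (J (x, posOne) (coneRadial (x, posOne)))) ∧
    (∀ (x : M) (v : TangentSpace 𝓘(ℝ, E) x), η x v = g x (ξ x) v) ∧
    (∀ (x : M) (v : TangentSpace 𝓘(ℝ, E) x),
      Φ x v = coneProj (x, posOne) (J (x, posOne) (coneIncl x v)))

end Cone

end STGeometry

end

noncomputable section

namespace STGeometry

/-! ### Multilinear algebra of 3-forms evaluated on explicit triples. -/

section ThreeForms

variable {E : Type*} [NormedAddCommGroup E] [NormedSpace ℝ E]
  {H : Type*} [TopologicalSpace H] {I : ModelWithCorners ℝ E H}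
  {M : Type*} [TopologicalSpace M] [ChartedSpace H M]

/-! Both sides of the equivalence are compared with one system on `M`, `SasakiEquations`: an almost
contact metric structure with `∇ᵀξ = Φ`, `(∇ᵀ_X Φ)Y = η(Y)X - g(X,Y)ξ`, and `T` free of a
`(3,0)+(0,3)` part in the sense of the identity involving `Φ`.

Cone side (`isSTTriple_iff_sasakiEquations`). Write `R = r ∂_r` and `∇̄` for the connection of the
cone with torsion `r²T`. On fields lifted from `M` one has `∇̄_X Y = ∇ᵀ_X Y - g(X,Y)R`, `∇̄_X R =
∇̄_R X = X` and `∇̄_R R = R`. If `∇̄J = 0`, then `∇̄_R(JY) = JY` for `Y` a lift or `R`, so `ḡ(JY,Z)`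
is homogeneous of degree two along rays for every lift `Z`. Hence `J` is determined by its values at
`r = 1`: it is the field `coneEndo ξ η Φ` (`IsKahlerWithTorsion.eq_coneEndo`). For such a `J`, the
components of `∇̄J` in the direction `R` vanish identically, and the others are `r²` times the
defects of the two differential equations. Once `J` is parallel, its Nijenhuis tensor involves only
the torsion (`nijenhuis_eq`), and its vanishing is the type condition on `T`.

Contact side (`sasakiEquations_iff`). The condition on `dᵀη` is the skew part of `∇ᵀξ = Φ`, the
Killing condition its symmetric part. For the second equation put `q(X,Y,Z) = g((∇ᵀ_X Φ)Y,Z)`. Its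
values with an argument `ξ` in the last two slots follow from `∇ᵀξ = Φ`, those with `X = ξ` from `ξ
⌟ dω = 0`. On `ker η`, expanding `dω` by `extDeriv₂_fundamentalForm` turns the Bismut condition into
the vanishing of the cyclic sum of `q`, and CR integrability kills the Nijenhuis combination of `q`.
As `q` is of type `(2,0)+(0,2)` in its last two arguments, these force `q = 0`
(`eq_zero_of_cyclic_of_nijenhuis`), as in Gauduchon's description of Hermitian connections. -/

theorem ThreeForm.swap₁₂ (T : ThreeForm I M) (x : M) (u v w : TangentSpace I x) :
    T x ![u, v, w] = -T x ![v, u, w] := by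
  have h : T x (![v, u, w] ∘ Equiv.swap (0 : Fin 3) 1) = -T x ![v, u, w] :=
    (T x).toAlternatingMap.map_swap ![v, u, w] (show (0 : Fin 3) ≠ 1 by decide)
  rw [← h]
  congr 1
  funext i
  fin_cases i <;> rfl

theorem ThreeForm.swap₂₃ (T : ThreeForm I M) (x : M) (u v w : TangentSpace I x) :
    T x ![u, v, w] = -T x ![u, w, v] := by
  have h : T x (![u, w, v] ∘ Equiv.swap (1 : Fin 3) 2) = -T x ![u, w, v] :=
    (T x).toAlternatingMap.map_swap ![u, w, v] (show (1 : Fin 3) ≠ 2 by decide)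
  rw [← h]
  congr 1
  funext i
  fin_cases i <;> rfl

theorem ThreeForm.add₁ (T : ThreeForm I M) (x : M) (u u' v w : TangentSpace I x) :
    T x ![u + u', v, w] = T x ![u, v, w] + T x ![u', v, w] := by
  have e : ∀ a, Function.update ![u, v, w] 0 a = ![a, v, w] := fun a => by
    funext i; fin_cases i <;> rfl
  simpa only [e] using (T x).map_update_add ![u, v, w] 0 u u'

theorem ThreeForm.smul₁ (T : ThreeForm I M) (x : M) (a : ℝ) (u v w : TangentSpace I x) :
    T x ![a • u, v, w] = a * T x ![u, v, w] := by
  have e : ∀ a, Function.update ![u, v, w] 0 a = ![a, v, w] := fun a => by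
    funext i; fin_cases i <;> rfl
  simpa only [e, smul_eq_mul] using (T x).map_update_smul ![u, v, w] 0 a u

theorem ThreeForm.neg₁ (T : ThreeForm I M) (x : M) (u v w : TangentSpace I x) :
    T x ![-u, v, w] = -T x ![u, v, w] := by
  simpa using T.smul₁ x (-1) u v w

theorem ThreeForm.zero₁ (T : ThreeForm I M) (x : M) (v w : TangentSpace I x) :
    T x ![0, v, w] = 0 := by
  simpa using T.smul₁ x 0 0 v w

theorem ThreeForm.add₂ (T : ThreeForm I M) (x : M) (u v v' w : TangentSpace I x) :
    T x ![u, v + v', w] = T x ![u, v, w] + T x ![u, v', w] := by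
  rw [T.swap₁₂ x u (v + v'), T.add₁, T.swap₁₂ x u v, T.swap₁₂ x u v']; ring

theorem ThreeForm.smul₂ (T : ThreeForm I M) (x : M) (a : ℝ) (u v w : TangentSpace I x) :
    T x ![u, a • v, w] = a * T x ![u, v, w] := by
  rw [T.swap₁₂ x u (a • v), T.smul₁, T.swap₁₂ x u v]; ring

theorem ThreeForm.neg₂ (T : ThreeForm I M) (x : M) (u v w : TangentSpace I x) :
    T x ![u, -v, w] = -T x ![u, v, w] := by
  simpa using T.smul₂ x (-1) u v w

theorem ThreeForm.zero₂ (T : ThreeForm I M) (x : M) (u w : TangentSpace I x) :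
    T x ![u, 0, w] = 0 := by
  simpa using T.smul₂ x 0 u 0 w

theorem ThreeForm.add₃ (T : ThreeForm I M) (x : M) (u v w w' : TangentSpace I x) :
    T x ![u, v, w + w'] = T x ![u, v, w] + T x ![u, v, w'] := by
  rw [T.swap₂₃ x u v (w + w'), T.add₂, T.swap₂₃ x u v w, T.swap₂₃ x u v w']; ring

theorem ThreeForm.smul₃ (T : ThreeForm I M) (x : M) (a : ℝ) (u v w : TangentSpace I x) :
    T x ![u, v, a • w] = a * T x ![u, v, w] := by
  rw [T.swap₂₃ x u v (a • w), T.smul₂, T.swap₂₃ x u v w]; ring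

theorem ThreeForm.neg₃ (T : ThreeForm I M) (x : M) (u v w : TangentSpace I x) :
    T x ![u, v, -w] = -T x ![u, v, w] := by
  simpa using T.smul₃ x (-1) u v w

theorem ThreeForm.zero₃ (T : ThreeForm I M) (x : M) (u v : TangentSpace I x) :
    T x ![u, v, 0] = 0 := by
  simpa using T.smul₃ x 0 u v 0

theorem ThreeForm.self₁₂ (T : ThreeForm I M) (x : M) (u w : TangentSpace I x) :
    T x ![u, u, w] = 0 := by
  linarith [T.swap₁₂ x u u w]

theorem ThreeForm.self₁₃ (T : ThreeForm I M) (x : M) (u v : TangentSpace I x) :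
    T x ![u, v, u] = 0 := by
  linarith [T.swap₂₃ x u v u, T.self₁₂ x u v]

theorem ThreeForm.self₂₃ (T : ThreeForm I M) (x : M) (u v : TangentSpace I x) :
    T x ![u, v, v] = 0 := by
  linarith [T.swap₂₃ x u v v]

end ThreeForms

/-! ### Directional derivatives of functions. -/

section DirDeriv

variable {E : Type*} [NormedAddCommGroup E] [NormedSpace ℝ E]
  {H : Type*} [TopologicalSpace H] {I : ModelWithCorners ℝ E H}
  {M : Type*} [TopologicalSpace M] [ChartedSpace H M]

theorem dirDeriv_add_field (X Y : VField I M) (f : M → ℝ) (x : M) :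
    dirDeriv (X + Y) f x = dirDeriv X f x + dirDeriv Y f x :=
  map_add (mvfderiv I f x) (X x) (Y x)

theorem dirDeriv_smul_field (c : M → ℝ) (X : VField I M) (f : M → ℝ) (x : M) :
    dirDeriv (c • X) f x = c x * dirDeriv X f x :=
  map_smul (mvfderiv I f x) (c x) (X x)

theorem dirDeriv_const (X : VField I M) (c : ℝ) (x : M) :
    dirDeriv X (fun _ => c) x = 0 := by
  simp [dirDeriv, mvfderiv_const]

theorem dirDeriv_add {X : VField I M} {f h : M → ℝ} {x : M}
    (hf : MDifferentiableAt I 𝓘(ℝ, ℝ) f x) (hh : MDifferentiableAt I 𝓘(ℝ, ℝ) h x) :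
    dirDeriv X (fun y => f y + h y) x = dirDeriv X f x + dirDeriv X h x := by
  simp [dirDeriv, mvfderiv_fun_add hf hh]

theorem dirDeriv_mul {X : VField I M} {f h : M → ℝ} {x : M}
    (hf : MDifferentiableAt I 𝓘(ℝ, ℝ) f x) (hh : MDifferentiableAt I 𝓘(ℝ, ℝ) h x) :
    dirDeriv X (fun y => f y * h y) x = f x * dirDeriv X h x + h x * dirDeriv X f x := by
  simp [dirDeriv, mvfderiv_fun_mul hf hh]

theorem dirDeriv_neg {X : VField I M} {f : M → ℝ} {x : M} :
    dirDeriv X (fun y => -f y) x = -dirDeriv X f x := by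
  simp [dirDeriv, mvfderiv_fun_neg]

theorem app_add (A : EndoField I M) (X Y : VField I M) : app A (X + Y) = app A X + app A Y :=
  funext fun x => map_add (A x) (X x) (Y x)

theorem app_smul (A : EndoField I M) (f : M → ℝ) (X : VField I M) : app A (f • X) = f • app A X :=
  funext fun x => map_smul (A x) (f x) (X x)

end DirDeriv

/-! ### The metric connection with skew torsion. -/

section Fields

variable {E : Type*} [NormedAddCommGroup E] [NormedSpace ℝ E]
  {H : Type*} [TopologicalSpace H] {I : ModelWithCorners ℝ E H}
  {M : Type*} [TopologicalSpace M] [ChartedSpace H M] [IsManifold I ∞ M]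

/-- A vector field is differentiable at a point, as a section of the tangent bundle. -/
def DiffVF (X : VField I M) (x : M) : Prop :=
  MDifferentiableAt I I.tangent (fun y : M => (⟨y, X y⟩ : TangentBundle I M)) x

theorem SmoothVF.diffVF {X : VField I M} (hX : SmoothVF X) (x : M) : DiffVF X x :=
  ContMDiff.mdifferentiable hX (by simp) x

theorem SmoothVF.neg {X : VField I M} (hX : SmoothVF X) : SmoothVF (-X) :=
  ContMDiff.neg_section hX

theorem DiffVF.add {X Y : VField I M} {x : M} (hX : DiffVF X x) (hY : DiffVF Y x) :
    DiffVF (X + Y) x :=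
  mdifferentiableAt_add_section hX hY

theorem DiffVF.smul {f : M → ℝ} {X : VField I M} {x : M} (hf : MDifferentiableAt I 𝓘(ℝ, ℝ) f x)
    (hX : DiffVF X x) : DiffVF (f • X) x :=
  MDifferentiableAt.smul_section hf hX

theorem SmoothEndo.diffVF_app {A : EndoField I M} (hA : SmoothEndo A) {X : VField I M} {x : M}
    (hX : DiffVF X x) : DiffVF (app A X) x :=
  (ContMDiff.mdifferentiable hA (by simp) _).comp x hX

theorem SmoothEndo.smoothVF_app {A : EndoField I M} (hA : SmoothEndo A) {X : VField I M}
    (hX : SmoothVF X) : SmoothVF (app A X) :=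
  ContMDiff.comp (f := fun y : M => (⟨y, X y⟩ : TangentBundle I M)) hA hX

theorem SmoothOneForm.contMDiff_apply {α : OneForm I M} (hα : SmoothOneForm α) {X : VField I M}
    (hX : SmoothVF X) : ContMDiff I 𝓘(ℝ, ℝ) ∞ (fun x => α x (X x)) :=
  ContMDiff.comp (f := fun y : M => (⟨y, X y⟩ : TangentBundle I M)) hα hX

/-- A field of inner products (not necessarily positive) which is differentiable on
differentiable vector fields. -/
structure IsDiffMetric (g : BilinField I M) : Prop where
  symm : ∀ (x : M) (v w : TangentSpace I x), g x v w = g x w v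
  nondeg : ∀ (x : M) (v : TangentSpace I x), (∀ w, g x v w = 0) → v = 0
  diff : ∀ {X Y : VField I M} {x : M}, DiffVF X x → DiffVF Y x →
    MDifferentiableAt I 𝓘(ℝ, ℝ) (fun y => g y (X y) (Y y)) x

theorem IsDiffMetric.flip {g : BilinField I M} (hg : IsDiffMetric g) (X Y : VField I M) :
    (fun y => g y (X y) (Y y)) = fun y => g y (Y y) (X y) :=
  funext fun y => hg.symm y _ _

section Connection

variable {g : BilinField I M} (hg : IsDiffMetric g) (T : ThreeForm I M)
include hg

/-- The connection `∇ᵀ` is metric. -/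
theorem torsionConnection_metric (X Y Z : VField I M) (x : M) :
    torsionConnection g T X Y Z x + torsionConnection g T X Z Y x
      = dirDeriv X (fun y => g y (Y y) (Z y)) x := by
  simp only [torsionConnection, leviCivita]
  rw [hg.flip Z Y, mlieBracket_swap_apply (V := Z) (W := Y), T.swap₂₃ x (X x) (Z x), map_neg]
  simp only [neg_apply]
  ring

/-- The torsion of `∇ᵀ` is `T`. -/
theorem torsionConnection_torsion (X Y Z : VField I M) (x : M) :
    torsionConnection g T X Y Z x - torsionConnection g T Y X Z x
      = g x (mlieBracket I X Y x) (Z x) + T x ![X x, Y x, Z x] := by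
  simp only [torsionConnection, leviCivita]
  rw [hg.flip Y X, mlieBracket_swap_apply (V := Y) (W := X), T.swap₁₂ x (Y x) (X x), map_neg]
  simp only [neg_apply]
  ring

variable [CompleteSpace E]

/-- Fields are only assumed differentiable at the point, because this is the generality in which
`TensorialAt` tests a candidate tensor. -/
theorem torsionConnection_add₁ {X X' Y Z : VField I M} {x : M} (hX : DiffVF X x)
    (hX' : DiffVF X' x) (hY : DiffVF Y x) (hZ : DiffVF Z x) :
    torsionConnection g T (X + X') Y Z x
      = torsionConnection g T X Y Z x + torsionConnection g T X' Y Z x := by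
  simp only [torsionConnection, leviCivita, dirDeriv_add_field, Pi.add_apply, map_add,
    add_apply, dirDeriv_add (hg.diff hX hZ) (hg.diff hX' hZ),
    dirDeriv_add (hg.diff hX hY) (hg.diff hX' hY), T.add₁]
  rw [mlieBracket_add_left hX hX', mlieBracket_add_left hX hX']
  simp only [map_add, add_apply]
  ring

/-- In the Koszul formula the derivatives of `f` coming from the metric terms cancel those coming
from the brackets. -/
theorem torsionConnection_smul₁ {f : M → ℝ} {X Y Z : VField I M} {x : M}
    (hf : MDifferentiableAt I 𝓘(ℝ, ℝ) f x) (hX : DiffVF X x)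
    (hY : DiffVF Y x) (hZ : DiffVF Z x) :
    torsionConnection g T (f • X) Y Z x = f x * torsionConnection g T X Y Z x := by
  simp only [torsionConnection, leviCivita, dirDeriv_smul_field, Pi.smul_apply', map_smul,
    smul_apply, smul_eq_mul, dirDeriv_mul hf (hg.diff hX hZ),
    dirDeriv_mul hf (hg.diff hX hY), T.smul₁]
  rw [mlieBracket_smul_left hf hX, mlieBracket_smul_left hf hX]
  simp only [map_add, map_smul, add_apply, smul_apply, smul_eq_mul]
  simp only [dirDeriv, hg.symm x (X x)]
  ring

theorem torsionConnection_add₃ {X Y Z Z' : VField I M} {x : M} (hX : DiffVF X x)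
    (hY : DiffVF Y x) (hZ : DiffVF Z x) (hZ' : DiffVF Z' x) :
    torsionConnection g T X Y (Z + Z') x
      = torsionConnection g T X Y Z x + torsionConnection g T X Y Z' x := by
  simp only [torsionConnection, leviCivita, dirDeriv_add_field, Pi.add_apply, map_add,
    dirDeriv_add (hg.diff hX hZ) (hg.diff hX hZ'),
    dirDeriv_add (hg.diff hY hZ) (hg.diff hY hZ'), T.add₃]
  rw [mlieBracket_add_right hZ hZ', mlieBracket_add_right hZ hZ']
  simp only [map_add, add_apply]
  ring

theorem torsionConnection_smul₃ {f : M → ℝ} {X Y Z : VField I M} {x : M}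
    (hf : MDifferentiableAt I 𝓘(ℝ, ℝ) f x) (hX : DiffVF X x)
    (hY : DiffVF Y x) (hZ : DiffVF Z x) :
    torsionConnection g T X Y (f • Z) x = f x * torsionConnection g T X Y Z x := by
  simp only [torsionConnection, leviCivita, dirDeriv_smul_field, Pi.smul_apply', map_smul,
    smul_eq_mul, dirDeriv_mul hf (hg.diff hX hZ),
    dirDeriv_mul hf (hg.diff hY hZ), T.smul₃]
  rw [mlieBracket_smul_right hf hZ, mlieBracket_smul_right hf hZ]
  simp only [map_add, map_smul, add_apply, smul_apply, smul_eq_mul]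
  simp only [dirDeriv, hg.symm x (Z x)]
  ring

theorem torsionConnection_neg₃ {X Y Z : VField I M} {x : M} (hX : DiffVF X x)
    (hY : DiffVF Y x) (hZ : DiffVF Z x) :
    torsionConnection g T X Y (-Z) x = -torsionConnection g T X Y Z x := by
  have h := torsionConnection_smul₃ hg T (f := fun _ : M => (-1 : ℝ)) mdifferentiableAt_const
    hX hY hZ
  have e : (fun _ : M => (-1 : ℝ)) • Z = -Z := funext fun y => neg_one_smul ℝ (Z y)
  rw [e] at h
  rw [h]; ring

/-- Metric compatibility exchanges the second and third slots, so the behaviour in the second one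
follows from that in the third. In the scalar case the derivative of `g(fY, Z)` supplies the Leibniz
term. -/
theorem torsionConnection_add₂ {X Y Y' Z : VField I M} {x : M} (hX : DiffVF X x)
    (hY : DiffVF Y x) (hY' : DiffVF Y' x) (hZ : DiffVF Z x) :
    torsionConnection g T X (Y + Y') Z x
      = torsionConnection g T X Y Z x + torsionConnection g T X Y' Z x := by
  have h := torsionConnection_metric hg T X (Y + Y') Z x
  rw [torsionConnection_add₃ hg T hX hZ hY hY'] at h
  have h₁ := torsionConnection_metric hg T X Y Z x
  have h₂ := torsionConnection_metric hg T X Y' Z x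
  have h₃ := dirDeriv_add (X := X) (hg.diff hY hZ) (hg.diff hY' hZ)
  simp only [Pi.add_apply, map_add, add_apply] at h
  linarith

theorem torsionConnection_smul₂ {f : M → ℝ} {X Y Z : VField I M} {x : M}
    (hf : MDifferentiableAt I 𝓘(ℝ, ℝ) f x) (hX : DiffVF X x)
    (hY : DiffVF Y x) (hZ : DiffVF Z x) :
    torsionConnection g T X (f • Y) Z x
      = f x * torsionConnection g T X Y Z x + dirDeriv X f x * g x (Y x) (Z x) := by
  have h := torsionConnection_metric hg T X (f • Y) Z x
  rw [torsionConnection_smul₃ hg T hf hX hZ hY] at h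
  have h₁ := torsionConnection_metric hg T X Y Z x
  have h₃ := dirDeriv_mul (X := X) hf (hg.diff hY hZ)
  simp only [Pi.smul_apply', map_smul, smul_apply, smul_eq_mul] at h
  linear_combination h + h₃ - f x * h₁

theorem torsionConnection_neg₂ {X Y Z : VField I M} {x : M} (hX : DiffVF X x)
    (hY : DiffVF Y x) (hZ : DiffVF Z x) :
    torsionConnection g T X (-Y) Z x = -torsionConnection g T X Y Z x := by
  have h := torsionConnection_smul₂ hg T (f := fun _ : M => (-1 : ℝ)) mdifferentiableAt_const
    hX hY hZ
  have e : (fun _ : M => (-1 : ℝ)) • Y = -Y := funext fun y => neg_one_smul ℝ (Y y)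
  rw [e, dirDeriv_const] at h
  rw [h]; ring

end Connection

end Fields

/-! ### The covariant derivative of an endomorphism field and its Nijenhuis tensor. -/

section Tensoriality

variable {E : Type*} [NormedAddCommGroup E] [NormedSpace ℝ E]
  {H : Type*} [TopologicalSpace H] {I : ModelWithCorners ℝ E H}
  {M : Type*} [TopologicalSpace M] [ChartedSpace H M] [IsManifold I ∞ M]

/-- Every tangent vector extends to a global smooth vector field. -/
theorem exists_smoothVF_eq [FiniteDimensional ℝ E] [T2Space M] (x : M) (v : TangentSpace I x) :
    ∃ X : VField I M, SmoothVF X ∧ X x = v := by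
  obtain ⟨s, hs, hX⟩ := FiberBundle.exists_contMDiffOn_extend (k := ∞) I E v
  obtain ⟨u, hus, hu, hxu⟩ := mem_nhds_iff.1 hs
  obtain ⟨ψ, -, hψ⟩ :=
    (SmoothBumpFunction.nhds_basis_tsupport (I := I) x).mem_iff.1 (hu.mem_nhds hxu)
  refine ⟨fun y => ψ y • FiberBundle.extend E v y,
    ContMDiffOn.smul_section_of_tsupport ψ.contMDiff.contMDiffOn hu hψ (hX.mono hus), ?_⟩
  simp

/-- The tensor `(∇ᴮ J)`, as a trilinear form `(X, Y, Z) ↦ g((∇ᴮ_X J) Y, Z)` for a `g`-skew field of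
endomorphisms `J`. -/
def endoDeriv (g : BilinField I M) (B : ThreeForm I M) (J : EndoField I M) (X Y Z : VField I M)
    (x : M) : ℝ :=
  torsionConnection g B X (app J Y) Z x + torsionConnection g B X Y (app J Z) x

variable {g : BilinField I M} (hg : IsDiffMetric g) (B : ThreeForm I M) {J : EndoField I M}
  (hJ : SmoothEndo J) (hskew : ∀ (x : M) (v w : TangentSpace I x), g x (J x v) w = -g x v (J x w))
include hg

-- Obtained by differentiating `g(JY, Z) = -g(Y, JZ)`. Thanks to this symmetry, tensoriality is only
-- needed in the first and third slots.
include hskew in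
theorem endoDeriv_swap (X Y Z : VField I M) (x : M) :
    endoDeriv g B J X Y Z x = -endoDeriv g B J X Z Y x := by
  have h₁ := torsionConnection_metric hg B X (app J Y) Z x
  have h₂ := torsionConnection_metric hg B X Y (app J Z) x
  have h₃ : (fun y => g y (app J Y y) (Z y)) = fun y => -g y (Y y) (app J Z y) :=
    funext fun y => hskew y _ _
  rw [h₃, dirDeriv_neg] at h₁
  unfold endoDeriv
  linarith

variable [CompleteSpace E]
include hskew in
/-- The Nijenhuis tensor of `J` in terms of `∇ᴮ J` and of the torsion `B`, on fields `X`, `Y` on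
which `J² = -1`. -/
theorem nijenhuis_eq {X Y Z : VField I M} {x : M} (hX : DiffVF X x)
    (hY : DiffVF Y x) (hZ : DiffVF Z x) (hXJ : app J (app J X) = -X) (hYJ : app J (app J Y) = -Y) :
    g x (mlieBracket I (app J X) (app J Y) x - mlieBracket I X Y x
      - J x (mlieBracket I X (app J Y) x + mlieBracket I (app J X) Y x)) (Z x)
    = endoDeriv g B J (app J X) Y Z x - endoDeriv g B J (app J Y) X Z x
      + endoDeriv g B J X (app J Y) Z x - endoDeriv g B J Y (app J X) Z x
      + B x ![X x, Y x, Z x] - B x ![app J X x, app J Y x, Z x]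
      - B x ![X x, app J Y x, app J Z x] - B x ![app J X x, Y x, app J Z x] := by
  -- Each bracket is replaced by `∇ᴮ_U V - ∇ᴮ_V U - B(U, V, ·)`, with `J` moved onto `Z` by
  -- skewness. The terms `∇ᴮ(J(JY))` inside `endoDeriv` are turned into `-∇ᴮY` by `J² = -1`.
  have e₁ := torsionConnection_torsion hg B (app J X) (app J Y) Z x
  have e₂ := torsionConnection_torsion hg B X Y Z x
  have e₃ := torsionConnection_torsion hg B X (app J Y) (app J Z) x
  have e₄ := torsionConnection_torsion hg B (app J X) Y (app J Z) x
  have n₁ := torsionConnection_neg₂ hg B hX hY hZ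
  have n₂ := torsionConnection_neg₂ hg B hY hX hZ
  simp only [map_sub, map_add, sub_apply, add_apply, hskew x (mlieBracket I X (app J Y) x),
    hskew x (mlieBracket I (app J X) Y x)]
  simp only [endoDeriv, hXJ, hYJ]
  simp only [app] at *
  linarith

include hJ

theorem endoDeriv_tensorial₁ {Y Z : VField I M} {x : M} (hY : DiffVF Y x) (hZ : DiffVF Z x) :
    TensorialAt I E (fun X => endoDeriv g B J X Y Z x) x where
  smul {f X} hf hX := by
    simp only [endoDeriv, torsionConnection_smul₁ hg B hf hX (hJ.diffVF_app hY) hZ,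
      torsionConnection_smul₁ hg B hf hX hY (hJ.diffVF_app hZ), smul_eq_mul]
    ring
  add {X X'} hX hX' := by
    simp only [endoDeriv, torsionConnection_add₁ hg B hX hX' (hJ.diffVF_app hY) hZ,
      torsionConnection_add₁ hg B hX hX' hY (hJ.diffVF_app hZ)]
    ring

theorem endoDeriv_tensorial₃ {X Y : VField I M} {x : M} (hX : DiffVF X x) (hY : DiffVF Y x) :
    TensorialAt I E (fun Z => endoDeriv g B J X Y Z x) x where
  smul {f Z} hf hZ := by
    simp only [endoDeriv, torsionConnection_smul₃ hg B hf hX (hJ.diffVF_app hY) hZ, app_smul,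
      torsionConnection_smul₃ hg B hf hX hY (hJ.diffVF_app hZ), smul_eq_mul]
    ring
  add {Z Z'} hZ hZ' := by
    simp only [endoDeriv, torsionConnection_add₃ hg B hX (hJ.diffVF_app hY) hZ hZ', app_add,
      torsionConnection_add₃ hg B hX hY (hJ.diffVF_app hZ) (hJ.diffVF_app hZ')]
    ring

end Tensoriality

/-! ### Lie brackets in a chart. -/

section ChartRepresentative

variable {E : Type*} [NormedAddCommGroup E] [NormedSpace ℝ E]
  {H : Type*} [TopologicalSpace H] {I : ModelWithCorners ℝ E H}
  {M : Type*} [TopologicalSpace M] [ChartedSpace H M]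

/-- The representative of a vector field in the preferred chart at `x₀`. -/
def chartField (X : VField I M) (x₀ : M) : E → E :=
  mpullbackWithin 𝓘(ℝ, E) I (extChartAt I x₀).symm X (Set.range I)

variable [I.Boundaryless]

theorem preimage_univ_inter_range (x₀ : M) :
    (extChartAt I x₀).symm ⁻¹' Set.univ ∩ Set.range I = Set.univ := by
  rw [ModelWithCorners.range_eq_univ, Set.preimage_univ, Set.univ_inter]

variable [IsManifold I ∞ M]

theorem DiffVF.differentiableAt_chartField [CompleteSpace E] {X : VField I M} {x₀ : M}
    (hX : DiffVF X x₀) : DifferentiableAt ℝ (chartField X x₀) (extChartAt I x₀ x₀) := by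
  have h : DifferentiableWithinAt ℝ (chartField X x₀)
      ((extChartAt I x₀).symm ⁻¹' Set.univ ∩ Set.range I) (extChartAt I x₀ x₀) :=
    MDifferentiableWithinAt.differentiableWithinAt_mpullbackWithin_vectorField
      (MDifferentiableAt.mdifferentiableWithinAt (s := Set.univ) hX)
  rwa [preimage_univ_inter_range, differentiableWithinAt_univ] at h

/-- The manifold bracket is by definition the pullback of the bracket of the chart representatives,
and the differential of the chart undoes this pullback. -/
theorem mfderiv_mlieBracket (X Y : VField I M) (x₀ : M) :
    (show E from mfderiv I 𝓘(ℝ, E) (extChartAt I x₀) x₀ (mlieBracket I X Y x₀))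
      = lieBracket ℝ (chartField X x₀) (chartField Y x₀) (extChartAt I x₀ x₀) := by
  have h : (show E from mfderiv I 𝓘(ℝ, E) (extChartAt I x₀) x₀ (mlieBracket I X Y x₀))
      = lieBracketWithin ℝ (chartField X x₀) (chartField Y x₀)
        ((extChartAt I x₀).symm ⁻¹' Set.univ ∩ Set.range I) (extChartAt I x₀ x₀) :=
    (isInvertible_mfderiv_extChartAt (mem_extChartAt_source x₀)).self_apply_inverse _
  rwa [preimage_univ_inter_range, lieBracketWithin_univ] at h

end ChartRepresentative

/-! ### Lie brackets of product vector fields. -/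

section ProductBracket

variable {E : Type*} [NormedAddCommGroup E] [NormedSpace ℝ E]
  {F : Type*} [NormedAddCommGroup F] [NormedSpace ℝ F]
  {M : Type*} [TopologicalSpace M] [ChartedSpace E M] [IsManifold 𝓘(ℝ, E) ∞ M]
  {N : Type*} [TopologicalSpace N] [ChartedSpace F N] [IsManifold 𝓘(ℝ, F) ∞ N]

/-- The vector field `(x, y) ↦ (X x, Y y)` on a product. -/
def prodField (X : VField 𝓘(ℝ, E) M) (Y : VField 𝓘(ℝ, F) N) :
    VField (𝓘(ℝ, E).prod 𝓘(ℝ, F)) (M × N) :=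
  fun p => ((X p.1, Y p.2) : E × F)

theorem mfderiv_extChartAt_prod (p : M × N) (v : TangentSpace (𝓘(ℝ, E).prod 𝓘(ℝ, F)) p) :
    (show E × F from mfderiv (𝓘(ℝ, E).prod 𝓘(ℝ, F)) 𝓘(ℝ, E × F)
      (extChartAt (𝓘(ℝ, E).prod 𝓘(ℝ, F)) p) p v)
      = ((show E from mfderiv 𝓘(ℝ, E) 𝓘(ℝ, E) (extChartAt 𝓘(ℝ, E) p.1) p.1 (show E × F from v).1),
        (show F from mfderiv 𝓘(ℝ, F) 𝓘(ℝ, F) (extChartAt 𝓘(ℝ, F) p.2) p.2 (show E × F from v).2)) := by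
  have h : MDifferentiableAt (𝓘(ℝ, E).prod 𝓘(ℝ, F)) 𝓘(ℝ, E × F)
      (extChartAt (𝓘(ℝ, E).prod 𝓘(ℝ, F)) p) p :=
    mdifferentiableAt_extChartAt (mem_chart_source _ p)
  have h₁ : MDifferentiableAt 𝓘(ℝ, E) 𝓘(ℝ, E) (extChartAt 𝓘(ℝ, E) p.1) p.1 :=
    mdifferentiableAt_extChartAt (mem_chart_source _ p.1)
  have h₂ : MDifferentiableAt 𝓘(ℝ, F) 𝓘(ℝ, F) (extChartAt 𝓘(ℝ, F) p.2) p.2 :=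
    mdifferentiableAt_extChartAt (mem_chart_source _ p.2)
  have f₁ : MDifferentiableAt 𝓘(ℝ, E × F) 𝓘(ℝ, E) (Prod.fst : E × F → E)
      (extChartAt (𝓘(ℝ, E).prod 𝓘(ℝ, F)) p p) := differentiableAt_fst.mdifferentiableAt
  have f₂ : MDifferentiableAt 𝓘(ℝ, E × F) 𝓘(ℝ, F) (Prod.snd : E × F → F)
      (extChartAt (𝓘(ℝ, E).prod 𝓘(ℝ, F)) p p) := differentiableAt_snd.mdifferentiableAt
  have c₁ := mfderiv_comp_apply p f₁ h v
  have c₂ := mfderiv_comp_apply p f₂ h v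
  have d₁ := mfderiv_comp_apply p h₁ mdifferentiableAt_fst v
  have d₂ := mfderiv_comp_apply p h₂ mdifferentiableAt_snd v
  rw [mfderiv_eq_fderiv, fderiv_fst] at c₁
  rw [mfderiv_eq_fderiv, fderiv_snd] at c₂
  rw [mfderiv_fst] at d₁
  rw [mfderiv_snd] at d₂
  exact Prod.ext (c₁.symm.trans d₁) (c₂.symm.trans d₂)

theorem mfderiv_extChartAt_symm_prod (p : M × N) {z : E × F}
    (hz : z ∈ (extChartAt (𝓘(ℝ, E).prod 𝓘(ℝ, F)) p).target) (v : E × F) :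
    (show E × F from mfderivWithin 𝓘(ℝ, E × F) (𝓘(ℝ, E).prod 𝓘(ℝ, F))
      (extChartAt (𝓘(ℝ, E).prod 𝓘(ℝ, F)) p).symm (Set.range (𝓘(ℝ, E).prod 𝓘(ℝ, F))) z v)
      = ((show E from mfderivWithin 𝓘(ℝ, E) 𝓘(ℝ, E) (extChartAt 𝓘(ℝ, E) p.1).symm
            (Set.range 𝓘(ℝ, E)) z.1 v.1),
        (show F from mfderivWithin 𝓘(ℝ, F) 𝓘(ℝ, F) (extChartAt 𝓘(ℝ, F) p.2).symm
            (Set.range 𝓘(ℝ, F)) z.2 v.2)) := by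
  have hz' := hz
  rw [extChartAt_prod, PartialEquiv.prod_target] at hz'
  have h := mdifferentiableWithinAt_extChartAt_symm hz
  have h₁ := mdifferentiableWithinAt_extChartAt_symm hz'.1
  have h₂ := mdifferentiableWithinAt_extChartAt_symm hz'.2
  simp only [ModelWithCorners.range_eq_univ, mfderivWithin_univ, mdifferentiableWithinAt_univ]
    at h h₁ h₂ ⊢
  have f₁ : MDifferentiableAt 𝓘(ℝ, E × F) 𝓘(ℝ, E) (Prod.fst : E × F → E) z :=
    differentiableAt_fst.mdifferentiableAt
  have f₂ : MDifferentiableAt 𝓘(ℝ, E × F) 𝓘(ℝ, F) (Prod.snd : E × F → F) z :=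
    differentiableAt_snd.mdifferentiableAt
  have c₁ := mfderiv_comp_apply z h₁ f₁ v
  have c₂ := mfderiv_comp_apply z h₂ f₂ v
  have d₁ := mfderiv_comp_apply z (mdifferentiableAt_fst (I := 𝓘(ℝ, E)) (I' := 𝓘(ℝ, F))) h v
  have d₂ := mfderiv_comp_apply z (mdifferentiableAt_snd (I := 𝓘(ℝ, E)) (I' := 𝓘(ℝ, F))) h v
  rw [mfderiv_eq_fderiv, fderiv_fst] at c₁
  rw [mfderiv_eq_fderiv, fderiv_snd] at c₂
  rw [mfderiv_fst] at d₁
  rw [mfderiv_snd] at d₂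
  exact Prod.ext (d₁.symm.trans c₁) (d₂.symm.trans c₂)

theorem chartField_prodField (X : VField 𝓘(ℝ, E) M) (Y : VField 𝓘(ℝ, F) N) (p : M × N)
    {z : E × F} (hz : z ∈ (extChartAt (𝓘(ℝ, E).prod 𝓘(ℝ, F)) p).target) :
    chartField (prodField X Y) p z = (chartField X p.1 z.1, chartField Y p.2 z.2) := by
  have hz' := hz
  rw [extChartAt_prod, PartialEquiv.prod_target] at hz'
  have i := isInvertible_mfderivWithin_extChartAt_symm hz
  have i₁ := isInvertible_mfderivWithin_extChartAt_symm hz'.1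
  have i₂ := isInvertible_mfderivWithin_extChartAt_symm hz'.2
  refine i.inverse_apply_eq.2 (Eq.symm ?_)
  refine (mfderiv_extChartAt_symm_prod p hz _).trans ?_
  exact Prod.ext (i₁.self_apply_inverse _) (i₂.self_apply_inverse _)

theorem lieBracket_prod {A A' : E → E} {B B' : F → F} {z : E × F}
    (hA : DifferentiableAt ℝ A z.1) (hA' : DifferentiableAt ℝ A' z.1)
    (hB : DifferentiableAt ℝ B z.2) (hB' : DifferentiableAt ℝ B' z.2) :
    lieBracket ℝ (fun z : E × F => (A z.1, B z.2)) (fun z : E × F => (A' z.1, B' z.2)) z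
      = (lieBracket ℝ A A' z.1, lieBracket ℝ B B' z.2) := by
  have h : ∀ {A : E → E} {B : F → F}, DifferentiableAt ℝ A z.1 → DifferentiableAt ℝ B z.2 →
      fderiv ℝ (fun z : E × F => (A z.1, B z.2)) z = (fderiv ℝ A z.1).prodMap (fderiv ℝ B z.2) :=
    fun hA hB => (hA.hasFDerivAt.prodMap z hB.hasFDerivAt).fderiv
  simp only [lieBracket, h hA hB, h hA' hB']
  rfl

/-- In a product chart both fields have the form `(A(z₁), B(z₂))`, whose derivative is block
diagonal, so the bracket splits. It is needed for the brackets of lifts and `r ∂_r` on the cone. -/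
theorem mlieBracket_prodField [CompleteSpace E] [CompleteSpace F]
    {X X' : VField 𝓘(ℝ, E) M} {Y Y' : VField 𝓘(ℝ, F) N} {p : M × N}
    (hX : DiffVF X p.1) (hX' : DiffVF X' p.1) (hY : DiffVF Y p.2) (hY' : DiffVF Y' p.2) :
    mlieBracket (𝓘(ℝ, E).prod 𝓘(ℝ, F)) (prodField X Y) (prodField X' Y') p
      = prodField (mlieBracket 𝓘(ℝ, E) X X') (mlieBracket 𝓘(ℝ, F) Y Y') p := by
  have i := isInvertible_mfderiv_extChartAt (I := 𝓘(ℝ, E).prod 𝓘(ℝ, F)) (mem_extChartAt_source p)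
  have hev : ∀ (V : VField 𝓘(ℝ, E) M) (W : VField 𝓘(ℝ, F) N),
      chartField (prodField V W) p =ᶠ[nhds (extChartAt (𝓘(ℝ, E).prod 𝓘(ℝ, F)) p p)]
        fun z => (chartField V p.1 z.1, chartField W p.2 z.2) := by
    intro V W
    filter_upwards [extChartAt_target_mem_nhds (I := 𝓘(ℝ, E).prod 𝓘(ℝ, F)) p] with z hz
    exact chartField_prodField V W p hz
  have e := (hev X Y).lieBracket_vectorField_eq (𝕜 := ℝ) (hev X' Y')
  refine i.injective ?_
  refine (mfderiv_mlieBracket (E := E × F) (I := 𝓘(ℝ, E).prod 𝓘(ℝ, F)) _ _ p).trans (e.trans ?_)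
  refine (lieBracket_prod (z := extChartAt (𝓘(ℝ, E).prod 𝓘(ℝ, F)) p p)
    hX.differentiableAt_chartField hX'.differentiableAt_chartField
    hY.differentiableAt_chartField hY'.differentiableAt_chartField).trans ?_
  refine Eq.trans ?_ (mfderiv_extChartAt_prod p _).symm
  exact Prod.ext (mfderiv_mlieBracket X X' p.1).symm (mfderiv_mlieBracket Y Y' p.2).symm

end ProductBracket

/-! ### Regularity of a Riemannian metric. -/

section RiemannianMetric

variable {E : Type*} [NormedAddCommGroup E] [NormedSpace ℝ E]
  {M : Type*} [TopologicalSpace M] [ChartedSpace E M] [IsManifold 𝓘(ℝ, E) ∞ M]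
  (g : Bundle.ContMDiffRiemannianMetric 𝓘(ℝ, E) ∞ E (fun x : M => TangentSpace 𝓘(ℝ, E) x))
  {E' : Type*} [NormedAddCommGroup E'] [NormedSpace ℝ E']
  {H' : Type*} [TopologicalSpace H'] {I' : ModelWithCorners ℝ E' H'}
  {N : Type*} [TopologicalSpace N] [ChartedSpace H' N]

/-- The vectors live along a map `b`, so that the metric can also be evaluated along the projection
of the tangent bundle, as in `smoothOneForm_dual`. -/
theorem contMDiff_metric_apply {b : N → M} {v w : ∀ n, TangentSpace 𝓘(ℝ, E) (b n)}
    (hv : ContMDiff I' 𝓘(ℝ, E).tangent ∞ (fun n => (⟨b n, v n⟩ : TangentBundle 𝓘(ℝ, E) M)))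
    (hw : ContMDiff I' 𝓘(ℝ, E).tangent ∞ (fun n => (⟨b n, w n⟩ : TangentBundle 𝓘(ℝ, E) M))) :
    ContMDiff I' 𝓘(ℝ, ℝ) ∞ (fun n => g.inner (b n) (v n) (w n)) := by
  intro n
  have hb : ContMDiffAt I' 𝓘(ℝ, E) ∞ b n :=
    (Bundle.contMDiffAt_proj (TangentSpace 𝓘(ℝ, E))).comp n (hv n)
  have h : ContMDiffAt I' (𝓘(ℝ, E).prod 𝓘(ℝ, ℝ)) ∞ (fun m => Bundle.TotalSpace.mk' ℝ
      (E := Bundle.Trivial M ℝ) (b m) (g.inner (b m) (v m) (w m))) n := by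
    apply ContMDiffAt.clm_bundle_apply₂ (F₁ := E) (F₂ := E)
    · exact ContMDiffAt.comp n (g.contMDiff _) hb
    · exact hv n
    · exact hw n
  exact ((Bundle.contMDiffAt_totalSpace).1 h).2

theorem mdifferentiableAt_metric_apply {b : N → M} {v w : ∀ n, TangentSpace 𝓘(ℝ, E) (b n)} {n : N}
    (hv : MDifferentiableAt I' 𝓘(ℝ, E).tangent
      (fun n => (⟨b n, v n⟩ : TangentBundle 𝓘(ℝ, E) M)) n)
    (hw : MDifferentiableAt I' 𝓘(ℝ, E).tangent
      (fun n => (⟨b n, w n⟩ : TangentBundle 𝓘(ℝ, E) M)) n) :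
    MDifferentiableAt I' 𝓘(ℝ, ℝ) (fun n => g.inner (b n) (v n) (w n)) n := by
  have hb : MDifferentiableAt I' 𝓘(ℝ, E) b n :=
    ((mdifferentiableAt_totalSpace _ _).1 hv).1
  have h : MDifferentiableAt I' (𝓘(ℝ, E).prod 𝓘(ℝ, ℝ)) (fun m => Bundle.TotalSpace.mk' ℝ
      (E := Bundle.Trivial M ℝ) (b m) (g.inner (b m) (v m) (w m))) n := by
    apply MDifferentiableAt.clm_bundle_apply₂ (F₁ := E) (F₂ := E)
    · exact MDifferentiableAt.comp n (g.contMDiff.mdifferentiable (by simp) _) hb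
    · exact hv
    · exact hw
  exact ((mdifferentiableAt_totalSpace _ _).1 h).2

theorem isDiffMetric_riemannian : IsDiffMetric g.inner where
  symm := g.symm
  nondeg x v h := by
    by_contra hv
    exact (g.pos x v hv).ne' (h v)
  diff hX hY := mdifferentiableAt_metric_apply g hX hY

end RiemannianMetric

section ProductFields

variable {E : Type*} [NormedAddCommGroup E] [NormedSpace ℝ E]
  {F : Type*} [NormedAddCommGroup F] [NormedSpace ℝ F]
  {M : Type*} [TopologicalSpace M] [ChartedSpace E M] [IsManifold 𝓘(ℝ, E) ∞ M]
  {N : Type*} [TopologicalSpace N] [ChartedSpace F N] [IsManifold 𝓘(ℝ, F) ∞ N]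

theorem SmoothVF.prodField {X : VField 𝓘(ℝ, E) M} {Y : VField 𝓘(ℝ, F) N} (hX : SmoothVF X)
    (hY : SmoothVF Y) : SmoothVF (prodField X Y) :=
  (contMDiff_equivTangentBundleProd_symm (I := 𝓘(ℝ, E)) (M := M) (I' := 𝓘(ℝ, F)) (M' := N)).comp
    ((ContMDiff.comp hX contMDiff_fst).prodMk (ContMDiff.comp hY contMDiff_snd))

theorem smoothVF_zero : SmoothVF (0 : VField 𝓘(ℝ, E) M) :=
  Bundle.contMDiff_zeroSection ℝ (TangentSpace 𝓘(ℝ, E))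

end ProductFields

/-! ### Lifts, the Euler field and the metric of the cone. -/

section Cone

variable {E : Type*} [NormedAddCommGroup E] [NormedSpace ℝ E]
  {M : Type*} [TopologicalSpace M] [ChartedSpace E M]

/-- The lift of a vector field on `M` to the cone, constant along the rays. -/
def coneLift (X : VField 𝓘(ℝ, E) M) : VField (𝓘(ℝ, E).prod 𝓘(ℝ, ℝ)) (Cone M) :=
  prodField X (0 : VField 𝓘(ℝ, ℝ) PosReal)

/-- The vector field `r ∂_r` on the half-line. -/
def posEuler : VField 𝓘(ℝ, ℝ) PosReal := fun r => (r : ℝ)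

/-- The vector field `r ∂_r` on the cone. -/
def coneEuler : VField (𝓘(ℝ, E).prod 𝓘(ℝ, ℝ)) (Cone M) :=
  prodField (0 : VField 𝓘(ℝ, E) M) posEuler

/-- Tangent vectors of the cone are determined by their horizontal and radial components. -/
theorem cone_ext {p : Cone M} {v w : TangentSpace (𝓘(ℝ, E).prod 𝓘(ℝ, ℝ)) p}
    (h₁ : coneProj p v = coneProj p w) (h₂ : coneDr p v = coneDr p w) : v = w := by
  rw [coneProj_apply, coneProj_apply] at h₁
  rw [coneDr_apply, coneDr_apply] at h₂
  exact Prod.ext h₁ h₂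

theorem coneProj_lift (X : VField 𝓘(ℝ, E) M) (p : Cone M) : coneProj p (coneLift X p) = X p.1 :=
  coneProj_apply p _

theorem coneDr_lift (X : VField 𝓘(ℝ, E) M) (p : Cone M) : coneDr p (coneLift X p) = 0 :=
  coneDr_apply p _

theorem coneProj_euler (p : Cone M) : coneProj (E := E) p (coneEuler p) = 0 :=
  coneProj_apply p _

theorem coneDr_euler (p : Cone M) : coneDr (E := E) p (coneEuler p) = p.2 :=
  coneDr_apply p _

theorem contMDiff_coneRadius :
    ContMDiff (𝓘(ℝ, E).prod 𝓘(ℝ, ℝ)) 𝓘(ℝ, ℝ) ∞ (fun q : Cone M => (q.2 : ℝ)) :=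
  (contMDiff_subtype_val (I := 𝓘(ℝ, ℝ)) (U := PosReal)).comp contMDiff_snd

theorem smoothVF_posEuler : SmoothVF posEuler := by
  intro r
  refine (Bundle.contMDiffAt_section _).2 ?_
  refine ((contMDiff_subtype_val (n := ∞) (I := 𝓘(ℝ, ℝ)) (U := PosReal)) r).congr_of_eventuallyEq ?_
  filter_upwards [(chartAt ℝ r).open_source.mem_nhds (mem_chart_source ℝ r)] with s hs
  -- The trivialization is the differential of the chart, which here is the inclusion into `ℝ`.
  -- Hence the coordinate of `r ∂_r` is `r` itself.
  have h := TangentBundle.continuousLinearMapAt_trivializationAt (𝕜 := ℝ) (I := 𝓘(ℝ, ℝ)) hs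
  have h' : (trivializationAt ℝ (TangentSpace 𝓘(ℝ, ℝ)) r).continuousLinearMapAt ℝ s (posEuler s)
    = posEuler s := by
    rw [h]
    exact mvfderiv_posReal_val s (posEuler s)
  rw [Bundle.Trivialization.continuousLinearMapAt_apply,
    Bundle.Trivialization.coe_linearMapAt_of_mem _ (by simpa using hs)] at h'
  exact h'

variable [IsManifold 𝓘(ℝ, E) ∞ M]

theorem SmoothVF.coneLift {X : VField 𝓘(ℝ, E) M} (hX : SmoothVF X) : SmoothVF (coneLift X) :=
  hX.prodField smoothVF_zero

theorem smoothVF_coneEuler : SmoothVF (coneEuler (E := E) (M := M)) :=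
  smoothVF_zero.prodField smoothVF_posEuler

theorem smoothOneForm_coneDr : SmoothOneForm (coneDr (E := E) (M := M)) := by
  have h : ContMDiff (𝓘(ℝ, E).prod 𝓘(ℝ, ℝ)) 𝓘(ℝ, ℝ) ∞ (fun q : Cone M => (q.2 : ℝ)) :=
    (contMDiff_subtype_val (I := 𝓘(ℝ, ℝ)) (U := PosReal)).comp contMDiff_snd
  exact (contMDiff_snd_tangentBundle_modelSpace ℝ 𝓘(ℝ, ℝ)).comp (h.contMDiff_tangentMap (by simp))

/-- The differential of the projection `C(M) → M`, as a map of tangent bundles, is smooth. -/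
theorem contMDiff_coneProj :
    ContMDiff (𝓘(ℝ, E).prod 𝓘(ℝ, ℝ)).tangent 𝓘(ℝ, E).tangent ∞
      (fun v : TangentBundle (𝓘(ℝ, E).prod 𝓘(ℝ, ℝ)) (Cone M) =>
        (⟨v.1.1, coneProj v.1 v.2⟩ : TangentBundle 𝓘(ℝ, E) M)) :=
  ContMDiff.contMDiff_tangentMap (n := ∞) contMDiff_fst (by simp)

/-- The differential of the inclusion `M → C(M)`, as a map of tangent bundles, is smooth. -/
theorem contMDiff_coneIncl :
    ContMDiff 𝓘(ℝ, E).tangent (𝓘(ℝ, E).prod 𝓘(ℝ, ℝ)).tangent ∞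
      (fun v : TangentBundle 𝓘(ℝ, E) M =>
        (⟨(v.1, posOne), coneIncl v.1 v.2⟩ :
          TangentBundle (𝓘(ℝ, E).prod 𝓘(ℝ, ℝ)) (Cone M))) :=
  ContMDiff.contMDiff_tangentMap (n := ∞) (contMDiff_id.prodMk contMDiff_const) (by simp)

theorem isDiffMetric_cone
    (g : Bundle.ContMDiffRiemannianMetric 𝓘(ℝ, E) ∞ E (fun x : M => TangentSpace 𝓘(ℝ, E) x)) :
    IsDiffMetric (coneMetric g.inner) where
  symm p v w := by
    rw [coneMetric_apply, coneMetric_apply, g.symm, mul_comm (coneDr p v)]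
  nondeg p v h := by
    -- Testing against `v` itself gives a sum of two nonnegative terms, so both components of `v`
    -- vanish.
    have hr : (0 : ℝ) < p.2 := p.2.2
    have h₁ := h v
    rw [coneMetric_apply] at h₁
    have h₂ : coneProj p v = 0 := by
      by_contra hv
      nlinarith [mul_pos (pow_pos hr 2) (g.pos p.1 _ hv), mul_self_nonneg (coneDr p v)]
    refine cone_ext (h₂.trans (map_zero _).symm) (Eq.trans ?_ (map_zero _).symm)
    rw [h₂, map_zero] at h₁
    simpa using h₁
  diff {X Y p} hX hY := by
    have hr := (contMDiff_coneRadius (E := E) (M := M)).mdifferentiable (by simp) p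
    have hdr : ∀ {Z : VField (𝓘(ℝ, E).prod 𝓘(ℝ, ℝ)) (Cone M)}, DiffVF Z p →
        MDifferentiableAt (𝓘(ℝ, E).prod 𝓘(ℝ, ℝ)) 𝓘(ℝ, ℝ) (fun q => coneDr q (Z q)) p := fun hZ =>
      (ContMDiff.mdifferentiable smoothOneForm_coneDr (by simp) _).comp p hZ
    have hpr : ∀ {Z : VField (𝓘(ℝ, E).prod 𝓘(ℝ, ℝ)) (Cone M)}, DiffVF Z p →
        MDifferentiableAt (𝓘(ℝ, E).prod 𝓘(ℝ, ℝ)) 𝓘(ℝ, E).tangent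
          (fun q => (⟨q.1, coneProj q (Z q)⟩ : TangentBundle 𝓘(ℝ, E) M)) p := fun hZ =>
      (ContMDiff.mdifferentiable contMDiff_coneProj (by simp) _).comp p hZ
    exact ((hdr hX).mul (hdr hY)).add
      ((hr.pow 2).mul (mdifferentiableAt_metric_apply g (hpr hX) (hpr hY)))

end Cone

/-! ### The torsion connection of the cone on lifts and `r ∂_r`. -/

section ConeConnection

variable {E : Type*} [NormedAddCommGroup E] [NormedSpace ℝ E]
  {M : Type*} [TopologicalSpace M] [ChartedSpace E M]

theorem coneThreeForm_apply (T : ThreeForm 𝓘(ℝ, E) M) (p : Cone M)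
    (u v w : TangentSpace (𝓘(ℝ, E).prod 𝓘(ℝ, ℝ)) p) :
    coneThreeForm T p ![u, v, w]
      = (p.2 : ℝ) ^ 2 * T p.1 ![coneProj p u, coneProj p v, coneProj p w] := by
  have e : (fun i => coneProj p (![u, v, w] i)) = ![coneProj p u, coneProj p v, coneProj p w] := by
    funext i; fin_cases i <;> rfl
  exact congrArg (fun a => (p.2 : ℝ) ^ 2 * T p.1 a) e

theorem coneMetric_lift_lift (g : BilinField 𝓘(ℝ, E) M) (X Y : VField 𝓘(ℝ, E) M) (p : Cone M) :
    coneMetric g p (coneLift X p) (coneLift Y p) = (p.2 : ℝ) ^ 2 * g p.1 (X p.1) (Y p.1) := by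
  rw [coneMetric_apply, coneProj_lift, coneProj_lift, coneDr_lift]; ring

theorem coneMetric_lift_euler (g : BilinField 𝓘(ℝ, E) M) (X : VField 𝓘(ℝ, E) M) (p : Cone M) :
    coneMetric g p (coneLift X p) (coneEuler p) = 0 := by
  rw [coneMetric_apply, coneProj_lift, coneProj_euler, coneDr_lift, map_zero]; ring

theorem coneMetric_euler_lift (g : BilinField 𝓘(ℝ, E) M) (X : VField 𝓘(ℝ, E) M) (p : Cone M) :
    coneMetric g p (coneEuler p) (coneLift X p) = 0 := by
  rw [coneMetric_apply, coneProj_euler, coneDr_lift, map_zero, zero_apply]; ring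

/-- The factor `1` is kept so that this component, like the others, has the shape `r²` times a
function on `M` required by `dirDeriv_sq_mul`. -/
theorem coneMetric_euler_euler (g : BilinField 𝓘(ℝ, E) M) (p : Cone M) :
    coneMetric g p (coneEuler p) (coneEuler p) = (p.2 : ℝ) ^ 2 * 1 := by
  rw [coneMetric_apply, coneProj_euler, coneDr_euler, map_zero]; ring

theorem dirDeriv_comp_fst {V : VField (𝓘(ℝ, E).prod 𝓘(ℝ, ℝ)) (Cone M)} {f : M → ℝ} {p : Cone M}
    (hf : MDifferentiableAt 𝓘(ℝ, E) 𝓘(ℝ, ℝ) f p.1) :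
    dirDeriv V (fun q => f q.1) p = mvfderiv 𝓘(ℝ, E) f p.1 (coneProj p (V p)) :=
  mvfderiv_comp_apply p hf mdifferentiableAt_fst (V p)

theorem mlieBracket_euler_euler (p : Cone M) :
    mlieBracket (𝓘(ℝ, E).prod 𝓘(ℝ, ℝ)) coneEuler coneEuler p = 0 := by
  rw [mlieBracket_self]; rfl

theorem dirDeriv_sq_mul {V : VField (𝓘(ℝ, E).prod 𝓘(ℝ, ℝ)) (Cone M)} {f : M → ℝ} {p : Cone M}
    (hf : MDifferentiableAt 𝓘(ℝ, E) 𝓘(ℝ, ℝ) f p.1) :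
    dirDeriv V (fun q => (q.2 : ℝ) ^ 2 * f q.1) p
      = (p.2 : ℝ) ^ 2 * mvfderiv 𝓘(ℝ, E) f p.1 (coneProj p (V p))
        + 2 * p.2 * f p.1 * coneDr p (V p) := by
  have hr : MDifferentiableAt (𝓘(ℝ, E).prod 𝓘(ℝ, ℝ)) 𝓘(ℝ, ℝ) (fun q : Cone M => (q.2 : ℝ)) p :=
    contMDiff_coneRadius.mdifferentiable (n := ∞) (by simp) p
  have hf' : MDifferentiableAt (𝓘(ℝ, E).prod 𝓘(ℝ, ℝ)) 𝓘(ℝ, ℝ) (fun q : Cone M => f q.1) p :=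
    hf.comp p mdifferentiableAt_fst
  have hrf : MDifferentiableAt (𝓘(ℝ, E).prod 𝓘(ℝ, ℝ)) 𝓘(ℝ, ℝ)
      (fun q : Cone M => (q.2 : ℝ) * f q.1) p := hr.mul hf'
  have e : (fun q : Cone M => (q.2 : ℝ) ^ 2 * f q.1)
      = fun q => (q.2 : ℝ) * ((q.2 : ℝ) * f q.1) := by
    funext q; ring
  have hd : dirDeriv V (fun q : Cone M => (q.2 : ℝ)) p = coneDr p (V p) := rfl
  rw [e, dirDeriv_mul hr hrf, dirDeriv_mul hr hf', dirDeriv_comp_fst hf, hd]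
  ring

theorem dirDeriv_lift_sq_mul (X : VField 𝓘(ℝ, E) M) {f : M → ℝ} {p : Cone M}
    (hf : MDifferentiableAt 𝓘(ℝ, E) 𝓘(ℝ, ℝ) f p.1) :
    dirDeriv (coneLift X) (fun q => (q.2 : ℝ) ^ 2 * f q.1) p
      = (p.2 : ℝ) ^ 2 * dirDeriv X f p.1 := by
  rw [dirDeriv_sq_mul hf, coneProj_lift, coneDr_lift]
  simp only [dirDeriv]
  ring

theorem dirDeriv_euler_sq_mul {f : M → ℝ} {p : Cone M}
    (hf : MDifferentiableAt 𝓘(ℝ, E) 𝓘(ℝ, ℝ) f p.1) :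
    dirDeriv (coneEuler (E := E)) (fun q => (q.2 : ℝ) ^ 2 * f q.1) p
      = 2 * ((p.2 : ℝ) ^ 2 * f p.1) := by
  rw [dirDeriv_sq_mul hf, coneProj_euler, coneDr_euler, map_zero]
  ring

/-- The eight evaluations of this kind amount to `∇̄_R R = R`, `∇̄_X R = ∇̄_R X = X` and `∇̄_X Y =
∇ᵀ_X Y - g(X,Y)R` with `R = r ∂_r`. The Euler field is preferred to `∂_r` because it acts on
degree-two functions as multiplication by two; it also commutes with lifts. -/
theorem coneConnection_euler_euler_euler (g : BilinField 𝓘(ℝ, E) M)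
    (T : ThreeForm 𝓘(ℝ, E) M) (p : Cone M) :
    torsionConnection (coneMetric g) (coneThreeForm T) coneEuler coneEuler coneEuler p
      = (p.2 : ℝ) ^ 2 := by
  simp only [torsionConnection, leviCivita, coneThreeForm_apply, mlieBracket_euler_euler,
    coneMetric_euler_euler, coneProj_euler, T.zero₁, map_zero, zero_apply,
    dirDeriv_euler_sq_mul (f := fun _ => 1) mdifferentiableAt_const]
  ring

variable [IsManifold 𝓘(ℝ, E) ∞ M] [CompleteSpace E]

theorem mlieBracket_lift_lift {X Y : VField 𝓘(ℝ, E) M} (hX : SmoothVF X) (hY : SmoothVF Y)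
    (p : Cone M) : mlieBracket (𝓘(ℝ, E).prod 𝓘(ℝ, ℝ)) (coneLift X) (coneLift Y) p
      = coneLift (mlieBracket 𝓘(ℝ, E) X Y) p := by
  refine (mlieBracket_prodField (hX.diffVF _) (hY.diffVF _) (smoothVF_zero.diffVF _)
    (smoothVF_zero.diffVF _)).trans ?_
  rw [mlieBracket_zero_left]; rfl

theorem mlieBracket_euler_lift {X : VField 𝓘(ℝ, E) M} (hX : SmoothVF X) (p : Cone M) :
    mlieBracket (𝓘(ℝ, E).prod 𝓘(ℝ, ℝ)) coneEuler (coneLift X) p = 0 := by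
  refine (mlieBracket_prodField (smoothVF_zero.diffVF _) (hX.diffVF _)
    (smoothVF_posEuler.diffVF _) (smoothVF_zero.diffVF _)).trans ?_
  rw [mlieBracket_zero_left, mlieBracket_zero_right]; rfl

theorem mlieBracket_lift_euler {X : VField 𝓘(ℝ, E) M} (hX : SmoothVF X) (p : Cone M) :
    mlieBracket (𝓘(ℝ, E).prod 𝓘(ℝ, ℝ)) (coneLift X) coneEuler p = 0 := by
  rw [mlieBracket_swap_apply, mlieBracket_euler_lift hX, neg_zero]

variable {g : BilinField 𝓘(ℝ, E) M} (T : ThreeForm 𝓘(ℝ, E) M)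
  {X Y Z : VField 𝓘(ℝ, E) M} (hX : SmoothVF X) (hY : SmoothVF Y) (hZ : SmoothVF Z) (p : Cone M)

include hX in
theorem coneConnection_lift_euler_euler :
    torsionConnection (coneMetric g) (coneThreeForm T) (coneLift X) coneEuler coneEuler p = 0 := by
  simp only [torsionConnection, leviCivita, coneThreeForm_apply,
    mlieBracket_lift_euler hX, mlieBracket_euler_euler, coneProj_lift,
    coneMetric_lift_euler, coneMetric_euler_euler, coneProj_euler, T.zero₂, dirDeriv_const,
    map_zero, zero_apply, dirDeriv_lift_sq_mul X (f := fun _ => 1) mdifferentiableAt_const]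
  ring

include hY in
theorem coneConnection_euler_lift_euler :
    torsionConnection (coneMetric g) (coneThreeForm T) coneEuler (coneLift Y) coneEuler p = 0 := by
  simp only [torsionConnection, leviCivita, coneThreeForm_apply,
    mlieBracket_lift_euler hY, mlieBracket_euler_lift hY, mlieBracket_euler_euler, coneProj_lift,
    coneMetric_lift_euler, coneMetric_euler_lift, coneMetric_euler_euler, coneProj_euler, T.zero₁,
    dirDeriv_const, map_zero, zero_apply,
    dirDeriv_lift_sq_mul Y (f := fun _ => 1) mdifferentiableAt_const]
  ring

include hZ in
theorem coneConnection_euler_euler_lift :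
    torsionConnection (coneMetric g) (coneThreeForm T) coneEuler coneEuler (coneLift Z) p = 0 := by
  simp only [torsionConnection, leviCivita, coneThreeForm_apply,
    mlieBracket_euler_lift hZ, mlieBracket_euler_euler, coneProj_lift,
    coneMetric_euler_lift, coneMetric_euler_euler, coneProj_euler, T.zero₁,
    dirDeriv_const, map_zero, zero_apply,
    dirDeriv_lift_sq_mul Z (f := fun _ => 1) mdifferentiableAt_const]
  ring

variable (hg : IsDiffMetric g)
include hg

include hX hY hZ in
theorem coneConnection_lift_lift_lift :
    torsionConnection (coneMetric g) (coneThreeForm T) (coneLift X) (coneLift Y) (coneLift Z) p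
      = (p.2 : ℝ) ^ 2 * torsionConnection g T X Y Z p.1 := by
  simp only [torsionConnection, leviCivita, coneThreeForm_apply, mlieBracket_lift_lift hX hY,
    mlieBracket_lift_lift hX hZ, mlieBracket_lift_lift hY hZ, coneMetric_lift_lift, coneProj_lift,
    dirDeriv_lift_sq_mul X (hg.diff (hY.diffVF p.1) (hZ.diffVF p.1)),
    dirDeriv_lift_sq_mul Y (hg.diff (hX.diffVF p.1) (hZ.diffVF p.1)),
    dirDeriv_lift_sq_mul Z (hg.diff (hX.diffVF p.1) (hY.diffVF p.1))]
  ring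

include hX hY in
theorem coneConnection_lift_lift_euler :
    torsionConnection (coneMetric g) (coneThreeForm T) (coneLift X) (coneLift Y) coneEuler p
      = -((p.2 : ℝ) ^ 2 * g p.1 (X p.1) (Y p.1)) := by
  simp only [torsionConnection, leviCivita, coneThreeForm_apply, mlieBracket_lift_lift hX hY,
    mlieBracket_lift_euler hX, mlieBracket_lift_euler hY, coneMetric_lift_lift, coneProj_lift,
    coneMetric_lift_euler, coneProj_euler, T.zero₃, dirDeriv_const, map_zero, zero_apply,
    dirDeriv_euler_sq_mul (hg.diff (hX.diffVF p.1) (hY.diffVF p.1))]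
  ring

include hX hZ in
theorem coneConnection_lift_euler_lift :
    torsionConnection (coneMetric g) (coneThreeForm T) (coneLift X) coneEuler (coneLift Z) p
      = (p.2 : ℝ) ^ 2 * g p.1 (X p.1) (Z p.1) := by
  simp only [torsionConnection, leviCivita, coneThreeForm_apply, mlieBracket_lift_lift hX hZ,
    mlieBracket_lift_euler hX, mlieBracket_euler_lift hZ, coneMetric_lift_lift, coneProj_lift,
    coneMetric_lift_euler, coneMetric_euler_lift, coneProj_euler, T.zero₂, dirDeriv_const, map_zero,
    zero_apply, dirDeriv_euler_sq_mul (hg.diff (hX.diffVF p.1) (hZ.diffVF p.1))]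
  ring

include hY hZ in
theorem coneConnection_euler_lift_lift :
    torsionConnection (coneMetric g) (coneThreeForm T) coneEuler (coneLift Y) (coneLift Z) p
      = (p.2 : ℝ) ^ 2 * g p.1 (Y p.1) (Z p.1) := by
  simp only [torsionConnection, leviCivita, coneThreeForm_apply, mlieBracket_lift_lift hY hZ,
    mlieBracket_euler_lift hY, mlieBracket_euler_lift hZ, coneMetric_lift_lift, coneProj_lift,
    coneMetric_lift_euler, coneMetric_euler_lift, coneProj_euler, T.zero₁, dirDeriv_const, map_zero,
    zero_apply, dirDeriv_euler_sq_mul (hg.diff (hY.diffVF p.1) (hZ.diffVF p.1))]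
  ring

end ConeConnection

/-! ### Almost contact metric structures and the Sasaki equations. -/

section AlmostContact

variable {E : Type*} [NormedAddCommGroup E] [NormedSpace ℝ E]
  {H : Type*} [TopologicalSpace H] {I : ModelWithCorners ℝ E H}
  {M : Type*} [TopologicalSpace M] [ChartedSpace H M] [IsManifold I ∞ M]
  {g : BilinField I M} {ξ : VField I M} {η : OneForm I M} {Φ : EndoField I M} {T : ThreeForm I M}

namespace IsAlmostContactMetric

variable (h : IsAlmostContactMetric g ξ η Φ)
include h

theorem xi_ne_zero (x : M) : ξ x ≠ 0 := fun e => by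
  simpa [e] using h.eta_xi x

/-- From `Φ²ξ = 0`, the formula for `Φ²` at `Φξ` makes `Φξ` a multiple `cξ`. Applying `Φ` once more
gives `c Φξ = 0`, and either factor being zero suffices. -/
theorem phi_xi (x : M) : Φ x (ξ x) = 0 := by
  have h₁ : Φ x (Φ x (ξ x)) = 0 := by rw [h.phi_sq, h.eta_xi, one_smul, neg_add_cancel]
  have h₂ := h.phi_sq x (Φ x (ξ x))
  rw [h₁, map_zero] at h₂
  have h₃ : Φ x (ξ x) = η x (Φ x (ξ x)) • ξ x := (neg_add_eq_zero.1 h₂.symm)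
  have h₄ : η x (Φ x (ξ x)) • Φ x (ξ x) = 0 := by
    rw [← map_smul, ← h₃, h₁]
  rcases smul_eq_zero.1 h₄ with h₅ | h₅
  · rw [h₃, h₅, zero_smul]
  · exact h₅

theorem eta_phi (x : M) (v : TangentSpace I x) : η x (Φ x v) = 0 := by
  have h₁ := h.phi_sq x (Φ x v)
  rw [h.phi_sq x v, map_add, map_neg, map_smul, h.phi_xi, smul_zero, add_zero] at h₁
  have h₂ : η x (Φ x v) • ξ x = 0 := (left_eq_add.1 h₁)
  exact (smul_eq_zero.1 h₂).resolve_right (h.xi_ne_zero x)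

theorem eta_eq (x : M) (v : TangentSpace I x) : g x (ξ x) v = η x v := by
  have h₁ := h.metric x (ξ x) v
  rw [h.phi_xi, map_zero, zero_apply, h.eta_xi, one_mul] at h₁
  linarith

theorem skew (x : M) (v w : TangentSpace I x) : g x (Φ x v) w = -g x v (Φ x w) := by
  have h₁ := h.metric x v (Φ x w)
  rw [h.phi_sq, map_add, map_neg, map_smul, h.eta_phi, smul_eq_mul] at h₁
  have h₂ := h.metric x (Φ x v) (ξ x)
  rw [h.phi_xi, map_zero, h.eta_xi, h.eta_phi] at h₂
  have h₃ : g x (Φ x v) (ξ x) = 0 := by linarith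
  rw [h₃] at h₁
  linarith

theorem app_app {X : VField I M} (hX : ∀ x, η x (X x) = 0) : app Φ (app Φ X) = -X :=
  funext fun x => (h.phi_sq x (X x)).trans (by rw [hX x, zero_smul, add_zero]; rfl)

theorem app_app_neg {X : VField I M} (hX : ∀ x, η x (X x) = 0) : app Φ (-app Φ X) = X :=
  funext fun x => (map_neg (Φ x) _).trans
    (by rw [← neg_neg (X x)]; exact congrArg Neg.neg (congrFun (h.app_app hX) x))

/-- Every vector field is the sum of a section of `ker η` and of a multiple of `ξ`. -/
theorem decompose (X : VField I M) : X = app Φ (-app Φ X) + (fun x => η x (X x)) • ξ := by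
  funext x
  have h₁ := h.phi_sq x (X x)
  change X x = Φ x (-Φ x (X x)) + η x (X x) • ξ x
  rw [map_neg, h₁, neg_add, neg_neg, neg_add_cancel_right]

theorem smooth_decompose {X : VField I M} (hX : SmoothVF X) : SmoothVF (app Φ (-app Φ X)) :=
  h.smooth_phi.smoothVF_app (h.smooth_phi.smoothVF_app hX).neg

/-- A tensorial operation vanishing on `ξ` and on the sections of `ker η` vanishes. -/
theorem tensorial_eq_zero {F : VField I M → ℝ} {x : M} (hF : TensorialAt I E F x) (hξ : F ξ = 0)
    (hD : ∀ X, SmoothVF X → (∀ x, η x (X x) = 0) → F X = 0) {X : VField I M} (hX : SmoothVF X) :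
    F X = 0 := by
  have hf : MDifferentiableAt I 𝓘(ℝ, ℝ) (fun x => η x (X x)) x :=
    (h.smooth_eta.contMDiff_apply hX).mdifferentiable (by simp) x
  have hξ' := h.smooth_xi.diffVF x
  rw [h.decompose X, hF.add ((h.smooth_decompose hX).diffVF x) (hξ'.smul hf), hF.smul hf hξ', hξ,
    hD _ (h.smooth_decompose hX) fun y => h.eta_phi y _]
  simp

end IsAlmostContactMetric

/-- The infinitesimal equations on `(ξ, η, Φ)` which characterise the Kähler with torsion
condition on the cone. -/
structure SasakiEquations (g : BilinField I M) (ξ : VField I M) (η : OneForm I M)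
    (Φ : EndoField I M) (T : ThreeForm I M) : Prop
    extends IsAlmostContactMetric g ξ η Φ where
  deriv_xi : ∀ X Y : VField I M, SmoothVF X → SmoothVF Y → ∀ x : M,
    torsionConnection g T X ξ Y x = g x (Φ x (X x)) (Y x)
  deriv_phi : ∀ X Y Z : VField I M, SmoothVF X → SmoothVF Y → SmoothVF Z → ∀ x : M,
    endoDeriv g T Φ X Y Z x = η x (Y x) * g x (X x) (Z x) - η x (Z x) * g x (X x) (Y x)
  torsion : ∀ (x : M) (u v w : TangentSpace I x),
    T x ![u, v, w] = T x ![u, Φ x v, Φ x w] + T x ![Φ x u, v, Φ x w] + T x ![Φ x u, Φ x v, w]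

/-- `T(ξ, ·, ·)` is of type `(1,1)`. -/
theorem IsAlmostContactMetric.torsion_xi (h : IsAlmostContactMetric g ξ η Φ)
    (ht : ∀ (x : M) (u v w : TangentSpace I x), T x ![u, v, w]
      = T x ![u, Φ x v, Φ x w] + T x ![Φ x u, v, Φ x w] + T x ![Φ x u, Φ x v, w])
    (x : M) (v w : TangentSpace I x) :
    T x ![ξ x, Φ x v, w] + T x ![ξ x, v, Φ x w] = 0 := by
  -- With first argument `ξ` only one term on the right survives; replacing `w` by `Φw` then brings
  -- in `Φ²w`, whose `ξ`-component is killed by alternation.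
  have h₁ := ht x (ξ x) v (Φ x w)
  rw [h.phi_xi, T.zero₁, T.zero₁, h.phi_sq, T.add₃, T.neg₃, T.smul₃, T.self₁₃] at h₁
  linarith

variable (hg : IsDiffMetric g)
include hg

/-- The exterior derivative of the fundamental 2-form in terms of `∇ᵀ`. -/
theorem extDeriv₂_fundamentalForm
    (hskew : ∀ (x : M) (v w : TangentSpace I x), g x (Φ x v) w = -g x v (Φ x w))
    (T : ThreeForm I M) (X Y Z : VField I M) (x : M) :
    extDeriv₂ (fundamentalForm g Φ) X Y Z x
      = endoDeriv g T Φ X Y Z x + endoDeriv g T Φ Y Z X x + endoDeriv g T Φ Z X Y x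
        - (T x ![X x, Y x, Φ x (Z x)] + T x ![Y x, Z x, Φ x (X x)] + T x ![Z x, X x, Φ x (Y x)]) := by
  have m₁ := torsionConnection_metric hg T X (app Φ Y) Z x
  have m₂ := torsionConnection_metric hg T Y (app Φ Z) X x
  have m₃ := torsionConnection_metric hg T Z (app Φ X) Y x
  have t₁ := torsionConnection_torsion hg T X Y (app Φ Z) x
  have t₂ := torsionConnection_torsion hg T Y Z (app Φ X) x
  have t₃ := torsionConnection_torsion hg T Z X (app Φ Y) x
  have s₁ := hskew x (mlieBracket I X Y x) (Z x)
  have s₂ := hskew x (mlieBracket I Y Z x) (X x)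
  have s₃ := hskew x (mlieBracket I Z X x) (Y x)
  simp only [extDeriv₂, fundamentalForm, ContinuousLinearMap.comp_apply, endoDeriv]
  simp only [app] at *
  linarith

/-- The Lie derivative of `g` along `ξ` is the symmetrization of `∇ᵀξ` for any skew torsion, since
the two terms `T(ξ,X,Y)` and `T(ξ,Y,X)` cancel. -/
theorem killing_eq (T : ThreeForm I M) (X Y : VField I M) (x : M) :
    dirDeriv ξ (fun y => g y (X y) (Y y)) x
      - g x (mlieBracket I ξ X x) (Y x) - g x (X x) (mlieBracket I ξ Y x)
    = torsionConnection g T X ξ Y x + torsionConnection g T Y ξ X x := by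
  have m := torsionConnection_metric hg T ξ X Y x
  have t₁ := torsionConnection_torsion hg T ξ X Y x
  have t₂ := torsionConnection_torsion hg T ξ Y X x
  rw [T.swap₂₃] at t₂
  rw [hg.symm x (X x)]
  linarith

variable (h : IsAlmostContactMetric g ξ η Φ)
include h

/-- The correction `-T(ξ,·,·)` in `dᵀη` is exactly what makes it the antisymmetrization of `∇ᵀξ`
rather than of the Levi-Civita derivative. -/
theorem torsionExtDeriv_eq (X Y : VField I M) (x : M) :
    torsionExtDeriv T ξ η X Y x
      = torsionConnection g T X ξ Y x - torsionConnection g T Y ξ X x := by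
  have e : ∀ Z : VField I M, (fun y => η y (Z y)) = fun y => g y (ξ y) (Z y) := fun Z =>
    funext fun y => (h.eta_eq y (Z y)).symm
  have m₁ := torsionConnection_metric hg T X ξ Y x
  have m₂ := torsionConnection_metric hg T Y ξ X x
  have t := torsionConnection_torsion hg T X Y ξ x
  rw [T.swap₂₃, T.swap₁₂] at t
  simp only [torsionExtDeriv, extDeriv₁, e]
  rw [← h.eta_eq x, hg.symm]
  linarith

/-- The two first-order conditions on `ξ` are equivalent to `∇ᵀ ξ = Φ`. -/
theorem deriv_xi_of_contact_killing
    (hc : ∀ X Y : VField I M, SmoothVF X → SmoothVF Y → ∀ x : M,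
      torsionExtDeriv T ξ η X Y x = 2 * fundamentalForm g Φ x (X x) (Y x))
    (hk : IsKilling g ξ) (X Y : VField I M) (hX : SmoothVF X) (hY : SmoothVF Y) (x : M) :
    torsionConnection g T X ξ Y x = g x (Φ x (X x)) (Y x) := by
  have h₁ := hc X Y hX hY x
  have h₂ := hk X Y hX hY x
  rw [torsionExtDeriv_eq hg h] at h₁
  rw [killing_eq hg T] at h₂
  simp only [fundamentalForm, ContinuousLinearMap.comp_apply] at h₁
  linarith

end AlmostContact

/-! ### Sasaki equations versus TK-contact, CR and Bismut conditions. -/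

section SasakiOfContact

variable {E : Type*} [NormedAddCommGroup E] [NormedSpace ℝ E]
  {H : Type*} [TopologicalSpace H] {I : ModelWithCorners ℝ E H}
  {M : Type*} [TopologicalSpace M] [ChartedSpace H M] [IsManifold I ∞ M]
  {g : BilinField I M} {ξ : VField I M} {η : OneForm I M} {Φ : EndoField I M} {T : ThreeForm I M}

/-- Differentiating `g(ξ, Y) = 0` trades the derivative of `Y` for that of `ξ`. -/
theorem torsionConnection_xi (hg : IsDiffMetric g) (h : IsAlmostContactMetric g ξ η Φ)
    (hξ : ∀ X Y : VField I M, SmoothVF X → SmoothVF Y → ∀ x : M,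
      torsionConnection g T X ξ Y x = g x (Φ x (X x)) (Y x))
    {X Y : VField I M} (hX : SmoothVF X) (hY : SmoothVF Y) (hYη : ∀ x, η x (Y x) = 0) (x : M) :
    torsionConnection g T X Y ξ x = -g x (Φ x (X x)) (Y x) := by
  have m := torsionConnection_metric hg T X ξ Y x
  have e : (fun y => g y (ξ y) (Y y)) = fun _ => (0 : ℝ) :=
    funext fun y => (h.eta_eq y (Y y)).trans (hYη y)
  rw [e, dirDeriv_const, hξ X Y hX hY] at m
  linarith

namespace SasakiEquations

variable (s : SasakiEquations g ξ η Φ T) (hg : IsDiffMetric g)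
include s hg

theorem isTKContactMetric : IsTKContactMetric g ξ η Φ T where
  toIsAlmostContactMetric := s.toIsAlmostContactMetric
  contact X Y hX hY x := by
    rw [torsionExtDeriv_eq hg s.toIsAlmostContactMetric, s.deriv_xi X Y hX hY,
      s.deriv_xi Y X hY hX, s.skew x (Y x), hg.symm x (Y x)]
    simp only [fundamentalForm, ContinuousLinearMap.comp_apply]
    ring
  interior X Y hX hY x := by
    have t := s.torsion_xi s.torsion x (X x) (Y x)
    rw [extDeriv₂_fundamentalForm hg s.skew T, s.deriv_phi ξ X Y s.smooth_xi hX hY,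
      s.deriv_phi X Y ξ hX hY s.smooth_xi, s.deriv_phi Y ξ X hY s.smooth_xi hX, s.phi_xi, T.zero₃,
      T.swap₁₂ x (Y x), T.swap₂₃ x (ξ x) (Y x), s.eta_eq, s.eta_eq, hg.symm x (X x) (ξ x),
      hg.symm x (Y x) (ξ x), s.eta_eq, s.eta_eq, s.eta_xi, hg.symm x (Y x)]
    linarith
  torsion := s.torsion
  killing X Y hX hY x := by
    rw [killing_eq hg T, s.deriv_xi X Y hX hY, s.deriv_xi Y X hY hX, s.skew x (Y x),
      hg.symm x (Y x)]
    ring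

/-- Since `η ∘ Φ = 0`, the covariant derivative of `Φ` contributes nothing to `dω(ΦX, ΦY, ΦZ)`. Only
torsion terms remain, and with `Φ² = -1` on `ker η` they form the right-hand side of the type
condition. -/
theorem isBismutOn : IsBismutOn g (contactDistribution η) Φ T := by
  intro X Y Z hX hY hZ hXη hYη hZη x
  have e : ∀ {W : VField I M}, (∀ x, W x ∈ contactDistribution η x) →
      Φ x (app Φ W x) = -W x := fun hW => by
    rw [app, s.phi_sq, show η x _ = 0 from hW x, zero_smul, add_zero]
  have f : ∀ {V W U : VField I M}, SmoothVF V → SmoothVF W → SmoothVF U →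
      endoDeriv g T Φ (app Φ V) (app Φ W) (app Φ U) x = 0 := fun {V W U} hV hW hU => by
    rw [s.deriv_phi _ _ _ (s.smooth_phi.smoothVF_app hV) (s.smooth_phi.smoothVF_app hW)
      (s.smooth_phi.smoothVF_app hU)]
    simp only [app, s.eta_phi]
    ring
  rw [extDeriv₂_fundamentalForm hg s.skew T, f hX hY hZ, f hY hZ hX, f hZ hX hY, e hXη, e hYη,
    e hZη, T.neg₃, T.neg₃, T.neg₃, s.torsion x (X x)]
  simp only [app]
  rw [T.swap₂₃ x (Φ x (X x)) (Y x), T.swap₁₂ x (Φ x (X x)) (Φ x (Z x)),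
    T.swap₁₂ x (X x), T.swap₂₃ x (Φ x (Y x)) (X x)]
  ring

theorem isIntegrableCR [FiniteDimensional ℝ E] [T2Space M] :
    IsIntegrableCR (contactDistribution η) Φ where
  maps_to x v _ := s.eta_phi x v
  sq x v hv := by rw [s.phi_sq, show η x v = 0 from hv, zero_smul, add_zero]
  bracket_mem X Y hX hY hXη hYη x := by
    have hΦX := s.smooth_phi.smoothVF_app hX
    have hΦY := s.smooth_phi.smoothVF_app hY
    have c : ∀ {V W : VField I M}, SmoothVF V → SmoothVF W → (∀ x, η x (W x) = 0) →
        torsionConnection g T V W ξ x = -g x (Φ x (V x)) (W x) := fun hV hW hWη =>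
      torsionConnection_xi hg s.toIsAlmostContactMetric s.deriv_xi hV hW hWη x
    -- The `ξ`-components of the two brackets are read off from the torsion formula. The metric
    -- terms cancel between them by skewness of `Φ`, and the torsion terms by `torsion_xi`.
    have t₁ := torsionConnection_torsion hg T (app Φ X) Y ξ x
    have t₂ := torsionConnection_torsion hg T X (app Φ Y) ξ x
    have t := s.torsion_xi s.torsion x (X x) (Y x)
    rw [c hΦX hY hYη, c hY hΦX fun y => s.eta_phi y _, T.swap₂₃, T.swap₁₂] at t₁
    rw [c hX hΦY (fun y => s.eta_phi y _), c hΦY hX hXη, T.swap₂₃, T.swap₁₂] at t₂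
    simp only [app] at t₁ t₂
    rw [s.skew x (Φ x (X x)), hg.symm x (Φ x (Y x))] at t₁
    rw [s.skew x (Φ x (Y x)), hg.symm x (Φ x (Y x))] at t₂
    refine (s.eta_eq x _).symm.trans ?_
    rw [hg.symm]
    simp only [map_add, add_apply]
    linarith
  nijenhuis X Y hX hY hXη hYη x := by
    have : CompleteSpace E := FiniteDimensional.complete ℝ E
    refine hg.nondeg x _ fun w => ?_
    obtain ⟨Z, hZ, rfl⟩ := exists_smoothVF_eq x w
    have hΦX := s.smooth_phi.smoothVF_app hX
    have hΦY := s.smooth_phi.smoothVF_app hY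
    have hX₀ : ∀ x, η x (X x) = 0 := hXη
    have hY₀ : ∀ x, η x (Y x) = 0 := hYη
    -- The terms in `η(X)`, `η(Y)` and `η ∘ Φ` vanish; those in `η(Z)` cancel in pairs because `Φ`
    -- is skew, and the torsion terms cancel by the type condition.
    rw [add_comm, nijenhuis_eq hg T s.skew (hX.diffVF x) (hY.diffVF x) (hZ.diffVF x)
      (s.app_app hX₀) (s.app_app hY₀), s.deriv_phi _ _ _ hΦX hY hZ, s.deriv_phi _ _ _ hΦY hX hZ,
      s.deriv_phi _ _ _ hX hΦY hZ, s.deriv_phi _ _ _ hY hΦX hZ, s.torsion x (X x), hX₀, hY₀]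
    simp only [app, s.eta_phi]
    rw [s.skew x (X x) (Y x), s.skew x (Y x) (X x)]
    ring

end SasakiEquations

/-- The linear algebra behind the Gauduchon description of Hermitian connections: a trilinear
form of type `(2,0) + (0,2)` in its last two arguments vanishes when its cyclic sum and the
associated Nijenhuis tensor do. -/
theorem eq_zero_of_cyclic_of_nijenhuis {V : Type*} {D : V → Prop} {J : V → V}
    (hJ : ∀ X, D X → D (J X)) {q : V → V → V → ℝ} (hsurj : ∀ X, D X → ∃ X', D X' ∧ J X' = X)
    (hskew : ∀ X Y Z, q X Y Z = -q X Z Y)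
    (htype : ∀ X Y Z, D X → D Y → D Z → q X (J Y) Z = q X Y (J Z))
    (hcyc : ∀ X Y Z, D X → D Y → D Z → q X Y Z + q Y Z X + q Z X Y = 0)
    (hnij : ∀ X Y Z, D X → D Y → D Z →
      q (J X) Y Z - q (J Y) X Z + q X (J Y) Z - q Y (J X) Z = 0)
    {X Y Z : V} (hX : D X) (hY : D Y) (hZ : D Z) : q X Y Z = 0 := by
  -- With `X = JW`, put `A = q(JW,Y,Z)`, `a = q(W,JY,Z) = q(W,Y,JZ)`, and let `B, b` and `C, c` be
  -- their cyclic analogues. The cyclic identities read `A+b+c = a+B+c = a+b+C = 0`, the Nijenhuis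
  -- ones `A+B+a+b = 0` and its analogues. Adding two of the former and subtracting one of the
  -- latter gives `2c = 0`; likewise `b = 0`, so `A = 0`.
  obtain ⟨W, hW, rfl⟩ := hsurj X hX
  linarith [hcyc (J W) Y Z (hJ W hW) hY hZ, hcyc W (J Y) Z hW (hJ Y hY) hZ,
    hcyc W Y (J Z) hW hY (hJ Z hZ), hnij W Y Z hW hY hZ, hnij Y Z W hY hZ hW, hnij Z W Y hZ hW hY,
    htype W Y Z hW hY hZ, htype Y Z W hY hZ hW, htype Z W Y hZ hW hY,
    hskew (J W) Z Y, hskew (J Y) W Z, hskew (J Z) Y W,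
    hskew Y (J W) Z, hskew Z (J Y) W, hskew W (J Z) Y]

theorem IsTKContactMetric.sasakiEquations [CompleteSpace E] (hg : IsDiffMetric g)
    (h : IsTKContactMetric g ξ η Φ T) (hcr : IsIntegrableCR (contactDistribution η) Φ)
    (hb : IsBismutOn g (contactDistribution η) Φ T) : SasakiEquations g ξ η Φ T := by
  have a := h.toIsAlmostContactMetric
  have hξ := deriv_xi_of_contact_killing hg a h.contact h.killing
  have hΦ : ∀ {X : VField I M}, SmoothVF X → SmoothVF (app Φ X) := fun hX =>
    a.smooth_phi.smoothVF_app hX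
  have hηΦ : ∀ (X : VField I M) x, η x (app Φ X x) = 0 := fun X x => a.eta_phi x _
  have q₃ : ∀ X Y, SmoothVF X → SmoothVF Y → ∀ x, endoDeriv g T Φ X Y ξ x
      = η x (Y x) * η x (X x) - g x (X x) (Y x) := by
    intro X Y hX hY x
    have e : app Φ ξ = 0 := funext fun y => a.phi_xi y
    -- As `Φξ = 0 = -0`, this says that the term with third argument `Φξ` equals its own negative,
    -- hence is zero.
    have c := torsionConnection_neg₃ hg T (hX.diffVF x) (hY.diffVF x)
      ((hΦ a.smooth_xi).diffVF x)
    have c' := torsionConnection_xi hg a hξ hX (hΦ hY) (hηΦ Y) x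
    rw [e, neg_zero] at c
    rw [endoDeriv, c', e, app, a.metric]
    linarith
  have q₁ : ∀ Y Z, SmoothVF Y → SmoothVF Z → ∀ x, endoDeriv g T Φ ξ Y Z x = 0 := by
    intro Y Z hY hZ x
    -- In the cyclic expansion of `dω(ξ,Y,Z)` the two terms with `ξ` in the last slots cancel, being
    -- symmetric in `Y` and `Z`, and the torsion terms cancel by `torsion_xi`.
    have i := h.interior Y Z hY hZ x
    have t := a.torsion_xi h.torsion x (Y x) (Z x)
    rw [extDeriv₂_fundamentalForm hg a.skew T, endoDeriv_swap hg T a.skew Z, q₃ Y Z hY hZ,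
      q₃ Z Y hZ hY, a.phi_xi, T.zero₃, T.swap₁₂ x (Z x), T.swap₂₃ x (ξ x) (Z x),
      hg.symm x (Z x)] at i
    linarith
  have q₀ : ∀ X Y Z, SmoothVF X → SmoothVF Y → SmoothVF Z → (∀ x, η x (X x) = 0) →
      (∀ x, η x (Y x) = 0) → (∀ x, η x (Z x) = 0) → ∀ x, endoDeriv g T Φ X Y Z x = 0 := by
    intro X Y Z hX hY hZ hXη hYη hZη x
    refine eq_zero_of_cyclic_of_nijenhuis (D := fun X : VField I M =>
      SmoothVF X ∧ ∀ x, η x (X x) = 0) (J := app Φ) (q := fun X Y Z => endoDeriv g T Φ X Y Z x)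
      (fun X hX => ⟨hΦ hX.1, hηΦ X⟩)
      (fun X hX => ⟨-app Φ X, ⟨(hΦ hX.1).neg, fun y => ?_⟩, a.app_app_neg hX.2⟩)
      (fun X Y Z => endoDeriv_swap hg T a.skew X Y Z x) ?_ ?_ ?_
      ⟨hX, hXη⟩ ⟨hY, hYη⟩ ⟨hZ, hZη⟩
    · exact (map_neg (η y) _).trans (neg_eq_zero.2 (hηΦ X y))
    · intro X Y Z hX hY hZ
      simp only [endoDeriv, a.app_app hY.2, a.app_app hZ.2,
        torsionConnection_neg₂ hg T (hX.1.diffVF x) (hY.1.diffVF x) (hZ.1.diffVF x),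
        torsionConnection_neg₃ hg T (hX.1.diffVF x) (hY.1.diffVF x) (hZ.1.diffVF x)]
      ring
    · intro X Y Z hX hY hZ
      have m : ∀ {X : VField I M}, ∀ x, (-app Φ X) x ∈ contactDistribution η x := fun {X} y =>
        (map_neg (η y) _).trans (neg_eq_zero.2 (hηΦ X y))
      -- On `ker η` the inverse of `Φ` is `-Φ`, so these arguments produce `dω(X,Y,Z)`. The type
      -- condition at `(ΦX, ΦY, ΦZ)` then cancels every torsion term and leaves the cyclic sum.
      have b := hb _ _ _ (hΦ hX.1).neg (hΦ hY.1).neg (hΦ hZ.1).neg m m m x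
      have t := h.torsion x (Φ x (X x)) (Φ x (Y x)) (Φ x (Z x))
      rw [a.app_app_neg hX.2, a.app_app_neg hY.2, a.app_app_neg hZ.2,
        extDeriv₂_fundamentalForm hg a.skew T] at b
      simp only [Pi.neg_apply, app, T.neg₁, T.neg₂, T.neg₃] at b
      simp only [a.phi_sq, hX.2, hY.2, hZ.2, zero_smul, add_zero, T.neg₁, T.neg₂, T.neg₃] at t
      linarith [T.swap₂₃ x (Y x) (Z x) (Φ x (X x)), T.swap₁₂ x (Y x) (Φ x (X x)) (Z x),
        T.swap₁₂ x (Z x) (X x) (Φ x (Y x)), T.swap₂₃ x (X x) (Z x) (Φ x (Y x))]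
    · intro X Y Z hX hY hZ
      have n := nijenhuis_eq hg T a.skew (hX.1.diffVF x) (hY.1.diffVF x) (hZ.1.diffVF x)
        (a.app_app hX.2) (a.app_app hY.2)
      rw [add_comm (mlieBracket I X (app Φ Y) x), hcr.nijenhuis X Y hX.1 hY.1 hX.2 hY.2 x, map_zero,
        zero_apply, h.torsion x (X x)] at n
      simp only [app] at n ⊢
      linarith
  have hη : ∀ {X : VField I M}, SmoothVF X → ∀ x, MDifferentiableAt I 𝓘(ℝ, ℝ)
      (fun y => η y (X y)) x := fun hX x =>
    (a.smooth_eta.contMDiff_apply hX).mdifferentiable (by simp) x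
  -- The defect of the second Sasaki equation is tensorial in `X` and `Z` and skew in `Y, Z`. It can
  -- therefore be tested one slot at a time on `ξ` and on sections of `ker η`, the second slot being
  -- reached by the skew symmetry.
  have t₃ : ∀ X Y, SmoothVF X → SmoothVF Y → ∀ x, TensorialAt I E (fun Z => endoDeriv g T Φ X Y Z x
      - (η x (Y x) * g x (X x) (Z x) - η x (Z x) * g x (X x) (Y x))) x := fun X Y hX hY x =>
    have t := endoDeriv_tensorial₃ hg T a.smooth_phi (hX.diffVF x) (hY.diffVF x)
    { smul := fun {f Z} hf hZ => by
        rw [t.smul hf hZ]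
        simp only [Pi.smul_apply', map_smul, smul_eq_mul]
        ring
      add := fun {Z Z'} hZ hZ' => by
        rw [t.add hZ hZ']
        simp only [Pi.add_apply, map_add]
        ring }
  have t₁ : ∀ Y Z, SmoothVF Y → SmoothVF Z → ∀ x, TensorialAt I E (fun X => endoDeriv g T Φ X Y Z x
      - (η x (Y x) * g x (X x) (Z x) - η x (Z x) * g x (X x) (Y x))) x := fun Y Z hY hZ x =>
    have t := endoDeriv_tensorial₁ hg T a.smooth_phi (hY.diffVF x) (hZ.diffVF x)
    { smul := fun {f X} hf hX => by
        rw [t.smul hf hX]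
        simp only [Pi.smul_apply', map_smul, smul_apply, smul_eq_mul]
        ring
      add := fun {X X'} hX hX' => by
        rw [t.add hX hX']
        simp only [Pi.add_apply, map_add, add_apply]
        ring }
  have d₃ : ∀ X Y, SmoothVF X → SmoothVF Y → ∀ x, endoDeriv g T Φ X Y ξ x
      - (η x (Y x) * g x (X x) (ξ x) - η x (ξ x) * g x (X x) (Y x)) = 0 := by
    intro X Y hX hY x
    rw [q₃ X Y hX hY, hg.symm x (X x) (ξ x), a.eta_eq, a.eta_xi]
    ring
  have r₁ : ∀ X Y Z, SmoothVF X → SmoothVF Y → SmoothVF Z → (∀ x, η x (X x) = 0) →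
      (∀ x, η x (Y x) = 0) → ∀ x, endoDeriv g T Φ X Y Z x
        - (η x (Y x) * g x (X x) (Z x) - η x (Z x) * g x (X x) (Y x)) = 0 :=
    fun X Y Z hX hY hZ hXη hYη x => a.tensorial_eq_zero (t₃ X Y hX hY x) (d₃ X Y hX hY x)
      (fun Z hZ hZη => by rw [q₀ X Y Z hX hY hZ hXη hYη hZη, hYη, hZη]; ring) hZ
  have r₂ : ∀ X Y Z, SmoothVF X → SmoothVF Y → SmoothVF Z → (∀ x, η x (X x) = 0) →
      ∀ x, endoDeriv g T Φ X Y Z x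
        - (η x (Y x) * g x (X x) (Z x) - η x (Z x) * g x (X x) (Y x)) = 0 :=
    fun X Y Z hX hY hZ hXη x => a.tensorial_eq_zero (t₃ X Y hX hY x) (d₃ X Y hX hY x)
      (fun Z hZ hZη => by
        have r := r₁ X Z Y hX hZ hY hXη hZη x
        rw [endoDeriv_swap hg T a.skew X Y]
        linarith) hZ
  refine { toIsAlmostContactMetric := a, deriv_xi := hξ, deriv_phi := ?_, torsion := h.torsion }
  intro X Y Z hX hY hZ x
  refine sub_eq_zero.1 (a.tensorial_eq_zero (t₁ Y Z hY hZ x) ?_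
    (fun X hX hXη => r₂ X Y Z hX hY hZ hXη x) hX)
  rw [q₁ Y Z hY hZ, a.eta_eq, a.eta_eq]
  ring

theorem sasakiEquations_iff [FiniteDimensional ℝ E] [T2Space M] (hg : IsDiffMetric g) :
    SasakiEquations g ξ η Φ T ↔
    IsTKContactMetric g ξ η Φ T ∧ IsIntegrableCR (contactDistribution η) Φ ∧
      IsBismutOn g (contactDistribution η) Φ T :=
  ⟨fun s => ⟨s.isTKContactMetric hg, s.isIntegrableCR hg, s.isBismutOn hg⟩,
    fun h =>
    have : CompleteSpace E := FiniteDimensional.complete ℝ E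
    h.1.sasakiEquations hg h.2.1 h.2.2⟩

end SasakiOfContact

/-! ### Smooth vector fields along a map. -/

section FieldsAlongMaps

variable {E : Type*} [NormedAddCommGroup E] [NormedSpace ℝ E]
  {H : Type*} [TopologicalSpace H] {I : ModelWithCorners ℝ E H}
  {M : Type*} [TopologicalSpace M] [ChartedSpace H M] [IsManifold I ∞ M]
  {E' : Type*} [NormedAddCommGroup E'] [NormedSpace ℝ E']
  {H' : Type*} [TopologicalSpace H'] {I' : ModelWithCorners ℝ E' H'}
  {N : Type*} [TopologicalSpace N] [ChartedSpace H' N]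
  {b : N → M} {v w : ∀ n, TangentSpace I (b n)}

/-- Needed because `coneEndo` is assembled, as a map on the tangent bundle of the cone, from vectors
lying over the composite projection to `M`. The proof uses fibrewise linearity of a trivialization.
-/
theorem contMDiff_add_along
    (hv : ContMDiff I' I.tangent ∞ (fun n => (⟨b n, v n⟩ : TangentBundle I M)))
    (hw : ContMDiff I' I.tangent ∞ (fun n => (⟨b n, w n⟩ : TangentBundle I M))) :
    ContMDiff I' I.tangent ∞ (fun n => (⟨b n, v n + w n⟩ : TangentBundle I M)) := by
  intro n
  have h₁ := Bundle.contMDiffAt_totalSpace.1 (hv n)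
  have h₂ := Bundle.contMDiffAt_totalSpace.1 (hw n)
  refine Bundle.contMDiffAt_totalSpace.2 ⟨h₁.1, (h₁.2.add h₂.2).congr_of_eventuallyEq ?_⟩
  filter_upwards [h₁.1.continuousAt.preimage_mem_nhds
    ((trivializationAt E (TangentSpace I) (b n)).open_baseSet.mem_nhds
      (FiberBundle.mem_baseSet_trivializationAt' (b n)))] with m hm
  exact ((trivializationAt E (TangentSpace I) (b n)).linear ℝ hm).1 _ _

theorem contMDiff_smul_along {f : N → ℝ} (hf : ContMDiff I' 𝓘(ℝ, ℝ) ∞ f)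
    (hv : ContMDiff I' I.tangent ∞ (fun n => (⟨b n, v n⟩ : TangentBundle I M))) :
    ContMDiff I' I.tangent ∞ (fun n => (⟨b n, f n • v n⟩ : TangentBundle I M)) := by
  intro n
  have h₁ := Bundle.contMDiffAt_totalSpace.1 (hv n)
  refine Bundle.contMDiffAt_totalSpace.2 ⟨h₁.1, ((hf n).smul h₁.2).congr_of_eventuallyEq ?_⟩
  filter_upwards [h₁.1.continuousAt.preimage_mem_nhds
    ((trivializationAt E (TangentSpace I) (b n)).open_baseSet.mem_nhds
      (FiberBundle.mem_baseSet_trivializationAt' (b n)))] with m hm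
  exact ((trivializationAt E (TangentSpace I) (b n)).linear ℝ hm).2 _ _

end FieldsAlongMaps

/-! ### The complex structure on the cone and its covariant derivative. -/

section ConeEndo

variable {E : Type*} [NormedAddCommGroup E] [NormedSpace ℝ E]
  {M : Type*} [TopologicalSpace M] [ChartedSpace E M]

/-- The almost complex structure on the cone defined by an almost contact structure:
`J X = Φ X - η(X) r ∂_r` for `X` tangent to `M`, and `J (r ∂_r) = ξ`. -/
def coneEndo (ξ : VField 𝓘(ℝ, E) M) (η : OneForm 𝓘(ℝ, E) M) (Φ : EndoField 𝓘(ℝ, E) M) :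
    EndoField (𝓘(ℝ, E).prod 𝓘(ℝ, ℝ)) (Cone M) := fun p =>
  show TangentSpace (𝓘(ℝ, E).prod 𝓘(ℝ, ℝ)) p →L[ℝ] E × ℝ from
    ContinuousLinearMap.prod
      (show TangentSpace (𝓘(ℝ, E).prod 𝓘(ℝ, ℝ)) p →L[ℝ] E from
        (Φ p.1).comp (coneProj p) + ((p.2 : ℝ)⁻¹ • coneDr p).smulRight (ξ p.1))
      (-((p.2 : ℝ) • (η p.1).comp (coneProj p)))

variable (ξ : VField 𝓘(ℝ, E) M) (η : OneForm 𝓘(ℝ, E) M) (Φ : EndoField 𝓘(ℝ, E) M)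

theorem coneProj_coneEndo (p : Cone M) (v : TangentSpace (𝓘(ℝ, E).prod 𝓘(ℝ, ℝ)) p) :
    coneProj p (coneEndo ξ η Φ p v)
      = Φ p.1 (coneProj p v) + ((p.2 : ℝ)⁻¹ * coneDr p v) • ξ p.1 :=
  coneProj_apply p _

theorem coneDr_coneEndo (p : Cone M) (v : TangentSpace (𝓘(ℝ, E).prod 𝓘(ℝ, ℝ)) p) :
    coneDr p (coneEndo ξ η Φ p v) = -((p.2 : ℝ) * η p.1 (coneProj p v)) :=
  coneDr_apply p _

theorem app_coneEndo_lift (X : VField 𝓘(ℝ, E) M) :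
    app (coneEndo ξ η Φ) (coneLift X)
      = coneLift (app Φ X) + (fun q : Cone M => -η q.1 (X q.1)) • coneEuler := by
  funext p
  apply cone_ext
  · rw [app, coneProj_coneEndo, Pi.add_apply, Pi.smul_apply', map_add, map_smul, coneProj_lift,
      coneProj_lift, coneProj_euler, coneDr_lift, mul_zero, zero_smul, smul_zero]
    rfl
  · rw [app, coneDr_coneEndo, Pi.add_apply, Pi.smul_apply', map_add, map_smul, coneProj_lift,
      coneDr_lift, coneDr_euler, smul_eq_mul]
    ring

theorem app_coneEndo_euler :
    app (coneEndo ξ η Φ) coneEuler = coneLift ξ := by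
  funext p
  have hr : (p.2 : ℝ) ≠ 0 := ne_of_gt p.2.2
  apply cone_ext
  · rw [app, coneProj_coneEndo, coneProj_lift, coneProj_euler, coneDr_euler, inv_mul_cancel₀ hr,
      one_smul, map_zero, zero_add]
  · rw [app, coneDr_coneEndo, coneProj_euler, coneDr_lift, map_zero, mul_zero, neg_zero]

variable {ξ η Φ} [IsManifold 𝓘(ℝ, E) ∞ M]

theorem smoothEndo_coneEndo (hξ : SmoothVF ξ) (hη : SmoothOneForm η) (hΦ : SmoothEndo Φ) :
    SmoothEndo (coneEndo ξ η Φ) := by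
  have hp : ContMDiff (𝓘(ℝ, E).prod 𝓘(ℝ, ℝ)).tangent (𝓘(ℝ, E).prod 𝓘(ℝ, ℝ)) ∞
      (fun v : TangentBundle (𝓘(ℝ, E).prod 𝓘(ℝ, ℝ)) (Cone M) => v.1) :=
    Bundle.contMDiff_proj (TangentSpace (𝓘(ℝ, E).prod 𝓘(ℝ, ℝ)))
  have hr : ContMDiff (𝓘(ℝ, E).prod 𝓘(ℝ, ℝ)).tangent 𝓘(ℝ, ℝ) ∞
      (fun v : TangentBundle (𝓘(ℝ, E).prod 𝓘(ℝ, ℝ)) (Cone M) => (v.1.2 : ℝ)) :=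
    contMDiff_coneRadius.comp hp
  have hp₁ : ContMDiff (𝓘(ℝ, E).prod 𝓘(ℝ, ℝ)).tangent 𝓘(ℝ, E) ∞
      (fun v : TangentBundle (𝓘(ℝ, E).prod 𝓘(ℝ, ℝ)) (Cone M) => v.1.1) := contMDiff_fst.comp hp
  have hp₂ : ContMDiff (𝓘(ℝ, E).prod 𝓘(ℝ, ℝ)).tangent 𝓘(ℝ, ℝ) ∞
      (fun v : TangentBundle (𝓘(ℝ, E).prod 𝓘(ℝ, ℝ)) (Cone M) => v.1.2) := contMDiff_snd.comp hp
  have a₁ : ContMDiff (𝓘(ℝ, E).prod 𝓘(ℝ, ℝ)).tangent 𝓘(ℝ, E).tangent ∞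
      (fun v : TangentBundle (𝓘(ℝ, E).prod 𝓘(ℝ, ℝ)) (Cone M) =>
        (⟨v.1.1, Φ v.1.1 (coneProj v.1 v.2)⟩ : TangentBundle 𝓘(ℝ, E) M)) :=
    (show ContMDiff _ _ _ _ from hΦ).comp contMDiff_coneProj
  have a₂ : ContMDiff (𝓘(ℝ, E).prod 𝓘(ℝ, ℝ)).tangent 𝓘(ℝ, E).tangent ∞
      (fun v : TangentBundle (𝓘(ℝ, E).prod 𝓘(ℝ, ℝ)) (Cone M) =>
        (⟨v.1.1, ξ v.1.1⟩ : TangentBundle 𝓘(ℝ, E) M)) :=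
    (show ContMDiff _ _ _ _ from hξ).comp hp₁
  have a₃ : ContMDiff (𝓘(ℝ, E).prod 𝓘(ℝ, ℝ)).tangent 𝓘(ℝ, ℝ) ∞
      (fun v : TangentBundle (𝓘(ℝ, E).prod 𝓘(ℝ, ℝ)) (Cone M) => -η v.1.1 (coneProj v.1 v.2)) :=
    ((show ContMDiff _ _ _ _ from hη).comp contMDiff_coneProj).neg
  have a₄ : ContMDiff (𝓘(ℝ, E).prod 𝓘(ℝ, ℝ)).tangent 𝓘(ℝ, ℝ).tangent ∞
      (fun v : TangentBundle (𝓘(ℝ, E).prod 𝓘(ℝ, ℝ)) (Cone M) =>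
        (⟨v.1.2, posEuler v.1.2⟩ : TangentBundle 𝓘(ℝ, ℝ) PosReal)) :=
    (show ContMDiff _ _ _ _ from smoothVF_posEuler).comp hp₂
  have a₅ : ContMDiff (𝓘(ℝ, E).prod 𝓘(ℝ, ℝ)).tangent 𝓘(ℝ, ℝ) ∞
      (fun v : TangentBundle (𝓘(ℝ, E).prod 𝓘(ℝ, ℝ)) (Cone M) =>
        (v.1.2 : ℝ)⁻¹ * coneDr v.1 v.2) :=
    (hr.inv₀ fun v => ne_of_gt v.1.2.2).mul smoothOneForm_coneDr
  have h₁ := contMDiff_add_along a₁ (contMDiff_smul_along a₅ a₂)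
  have h₂ := contMDiff_smul_along a₃ a₄
  refine ((contMDiff_equivTangentBundleProd_symm (n := ∞) (I := 𝓘(ℝ, E)) (M := M) (I' := 𝓘(ℝ, ℝ))
    (M' := PosReal)).comp (h₁.prodMk h₂)).congr fun v => ?_
  refine congrArg (Bundle.TotalSpace.mk v.1) (cone_ext ?_ ?_)
  · refine (coneProj_coneEndo ξ η Φ v.1 v.2).trans
      (Eq.trans ?_ (coneProj_apply (E := E) v.1 _).symm)
    rfl
  · refine (coneDr_coneEndo ξ η Φ v.1 v.2).trans (Eq.trans ?_ (coneDr_apply v.1 _).symm)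
    exact (show -((v.1.2 : ℝ) * η v.1.1 (coneProj v.1 v.2))
      = -η v.1.1 (coneProj v.1 v.2) * v.1.2 by ring)

variable {g : BilinField 𝓘(ℝ, E) M} (h : IsAlmostContactMetric g ξ η Φ)
include h

theorem coneEndo_sq (p : Cone M) (v : TangentSpace (𝓘(ℝ, E).prod 𝓘(ℝ, ℝ)) p) :
    coneEndo ξ η Φ p (coneEndo ξ η Φ p v) = -v := by
  have hr : (p.2 : ℝ) ≠ 0 := ne_of_gt p.2.2
  apply cone_ext
  · rw [coneProj_coneEndo, coneProj_coneEndo, coneDr_coneEndo, map_add, map_smul, h.phi_xi,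
      h.phi_sq, smul_zero, add_zero, mul_neg, inv_mul_cancel_left₀ hr, neg_smul, map_neg,
      add_neg_cancel_right]
  · rw [coneDr_coneEndo, coneProj_coneEndo, map_add, map_smul, h.eta_phi, h.eta_xi, map_neg,
      zero_add, smul_eq_mul, mul_one, mul_inv_cancel_left₀ hr]

theorem coneEndo_isometric (hg : IsDiffMetric g) (p : Cone M)
    (v w : TangentSpace (𝓘(ℝ, E).prod 𝓘(ℝ, ℝ)) p) :
    coneMetric g p (coneEndo ξ η Φ p v) (coneEndo ξ η Φ p w) = coneMetric g p v w := by
  have hr : (p.2 : ℝ) ≠ 0 := ne_of_gt p.2.2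
  simp only [coneMetric_apply, coneDr_coneEndo, coneProj_coneEndo, map_add, map_smul, add_apply,
    smul_apply, smul_eq_mul, h.metric, h.eta_eq, h.eta_phi, h.eta_xi,
    hg.symm p.1 (Φ p.1 (coneProj p v)) (ξ p.1)]
  field_simp
  ring

theorem coneEndo_skew (hg : IsDiffMetric g) (p : Cone M)
    (v w : TangentSpace (𝓘(ℝ, E).prod 𝓘(ℝ, ℝ)) p) :
    coneMetric g p (coneEndo ξ η Φ p v) w = -coneMetric g p v (coneEndo ξ η Φ p w) := by
  rw [← coneEndo_isometric h hg p v, coneEndo_sq h, map_neg, neg_neg]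

theorem smoothEndo_coneEndo_of_isAlmostContactMetric : SmoothEndo (coneEndo ξ η Φ) :=
  smoothEndo_coneEndo h.smooth_xi h.smooth_eta h.smooth_phi

variable [CompleteSpace E] (hG : IsDiffMetric (coneMetric g)) (T : ThreeForm 𝓘(ℝ, E) M)
  {X Y Z : VField 𝓘(ℝ, E) M} (hX : SmoothVF X) (hY : SmoothVF Y) (hZ : SmoothVF Z) (p : Cone M)
include hG

/-- The derivative of `J Y` on the cone, where `Y` is tangent to `M`. -/
theorem coneConnection_coneEndo_lift {V W : VField (𝓘(ℝ, E).prod 𝓘(ℝ, ℝ)) (Cone M)}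
    (hV : SmoothVF V) (hY : SmoothVF Y) (hW : SmoothVF W) :
    torsionConnection (coneMetric g) (coneThreeForm T) V (app (coneEndo ξ η Φ) (coneLift Y)) W p
      = torsionConnection (coneMetric g) (coneThreeForm T) V (coneLift (app Φ Y)) W p
        - η p.1 (Y p.1) * torsionConnection (coneMetric g) (coneThreeForm T) V coneEuler W p
        - mvfderiv 𝓘(ℝ, E) (fun x => η x (Y x)) p.1 (coneProj p (V p))
          * coneMetric g p (coneEuler p) (W p) := by
  have hf : MDifferentiableAt 𝓘(ℝ, E) 𝓘(ℝ, ℝ) (fun x => η x (Y x)) p.1 :=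
    (h.smooth_eta.contMDiff_apply hY).mdifferentiable (by simp) _
  have hf' : MDifferentiableAt (𝓘(ℝ, E).prod 𝓘(ℝ, ℝ)) 𝓘(ℝ, ℝ)
      (fun q : Cone M => -η q.1 (Y q.1)) p := (hf.comp p mdifferentiableAt_fst).neg
  have hR := (smoothVF_coneEuler (E := E) (M := M)).diffVF p
  rw [app_coneEndo_lift, torsionConnection_add₂ hG _ (hV.diffVF p)
    ((h.smooth_phi.smoothVF_app hY).coneLift.diffVF p) (hR.smul hf') (hW.diffVF p),
    torsionConnection_smul₂ hG _ hf' (hV.diffVF p) hR (hW.diffVF p), dirDeriv_neg,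
    dirDeriv_comp_fst hf]
  ring

theorem coneConnection_lift_coneEndo {V W : VField (𝓘(ℝ, E).prod 𝓘(ℝ, ℝ)) (Cone M)}
    (hV : SmoothVF V) (hY : SmoothVF Y) (hW : SmoothVF W) :
    torsionConnection (coneMetric g) (coneThreeForm T) V W (app (coneEndo ξ η Φ) (coneLift Y)) p
      = torsionConnection (coneMetric g) (coneThreeForm T) V W (coneLift (app Φ Y)) p
        - η p.1 (Y p.1) * torsionConnection (coneMetric g) (coneThreeForm T) V W coneEuler p := by
  have hf : MDifferentiableAt 𝓘(ℝ, E) 𝓘(ℝ, ℝ) (fun x => η x (Y x)) p.1 :=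
    (h.smooth_eta.contMDiff_apply hY).mdifferentiable (by simp) _
  have hf' : MDifferentiableAt (𝓘(ℝ, E).prod 𝓘(ℝ, ℝ)) 𝓘(ℝ, ℝ)
      (fun q : Cone M => -η q.1 (Y q.1)) p := (hf.comp p mdifferentiableAt_fst).neg
  have hR := (smoothVF_coneEuler (E := E) (M := M)).diffVF p
  rw [app_coneEndo_lift, torsionConnection_add₃ hG _ (hV.diffVF p) (hW.diffVF p)
    ((h.smooth_phi.smoothVF_app hY).coneLift.diffVF p) (hR.smul hf'),
    torsionConnection_smul₃ hG _ hf' (hV.diffVF p) (hW.diffVF p) hR]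
  ring

variable (hg : IsDiffMetric g)
include hg

-- The first component of `∇̄J` with content. It uses `JR = ξ` and, to pass from `∇ᵀY` to `∇ᵀξ`, the
-- derivative of `g(ξ,Y) = η(Y)`.
include hX hY in
theorem endoDeriv_coneEndo_lift_lift_euler :
    endoDeriv (coneMetric g) (coneThreeForm T) (coneEndo ξ η Φ) (coneLift X) (coneLift Y)
        coneEuler p
      = (p.2 : ℝ) ^ 2 * (g p.1 (Φ p.1 (X p.1)) (Y p.1) - torsionConnection g T X ξ Y p.1) := by
  have m := torsionConnection_metric hg T X ξ Y p.1
  simp only [h.eta_eq] at m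
  have hΦY := h.smooth_phi.smoothVF_app hY
  rw [endoDeriv, app_coneEndo_euler,
    coneConnection_coneEndo_lift h hG T p hX.coneLift hY smoothVF_coneEuler,
    coneConnection_lift_lift_euler T hX hΦY p hg, coneConnection_lift_euler_euler T hX p,
    coneConnection_lift_lift_lift T hX hY h.smooth_xi p hg, coneMetric_euler_euler,
    coneProj_lift, app, h.skew]
  rw [dirDeriv] at m
  linear_combination (p.2 : ℝ) ^ 2 * m

include hX hY hZ in
theorem endoDeriv_coneEndo_lift_lift_lift :
    endoDeriv (coneMetric g) (coneThreeForm T) (coneEndo ξ η Φ) (coneLift X) (coneLift Y)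
        (coneLift Z) p
      = (p.2 : ℝ) ^ 2 * (endoDeriv g T Φ X Y Z p.1
        - (η p.1 (Y p.1) * g p.1 (X p.1) (Z p.1) - η p.1 (Z p.1) * g p.1 (X p.1) (Y p.1))) := by
  have hΦY := h.smooth_phi.smoothVF_app hY
  have hΦZ := h.smooth_phi.smoothVF_app hZ
  rw [endoDeriv, coneConnection_coneEndo_lift h hG T p hX.coneLift hY hZ.coneLift,
    coneConnection_lift_coneEndo h hG T p hX.coneLift hZ hY.coneLift,
    coneConnection_lift_lift_lift T hX hΦY hZ p hg, coneConnection_lift_lift_lift T hX hY hΦZ p hg,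
    coneConnection_lift_euler_lift T hX hZ p hg, coneConnection_lift_lift_euler T hX hY p hg,
    coneMetric_euler_lift, endoDeriv]
  ring

-- The derivative in the direction `R` vanishes without any differential equation on the triple:
-- `∇̄_R` fixes lifts and `R`, and `coneEndo` maps these to combinations with coefficients constant
-- along rays.
include hY in
theorem endoDeriv_coneEndo_euler_lift_euler :
    endoDeriv (coneMetric g) (coneThreeForm T) (coneEndo ξ η Φ) coneEuler (coneLift Y)
        coneEuler p = 0 := by
  have hΦY := h.smooth_phi.smoothVF_app hY
  rw [endoDeriv, app_coneEndo_euler,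
    coneConnection_coneEndo_lift h hG T p smoothVF_coneEuler hY smoothVF_coneEuler,
    coneConnection_euler_lift_euler T hΦY p, coneConnection_euler_euler_euler,
    coneConnection_euler_lift_lift T hY h.smooth_xi p hg, coneMetric_euler_euler,
    coneProj_euler, map_zero, hg.symm, h.eta_eq]
  ring

include hY hZ in
theorem endoDeriv_coneEndo_euler_lift_lift :
    endoDeriv (coneMetric g) (coneThreeForm T) (coneEndo ξ η Φ) coneEuler (coneLift Y)
        (coneLift Z) p = 0 := by
  have hΦY := h.smooth_phi.smoothVF_app hY
  have hΦZ := h.smooth_phi.smoothVF_app hZ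
  rw [endoDeriv, coneConnection_coneEndo_lift h hG T p smoothVF_coneEuler hY hZ.coneLift,
    coneConnection_lift_coneEndo h hG T p smoothVF_coneEuler hZ hY.coneLift,
    coneConnection_euler_lift_lift T hΦY hZ p hg, coneConnection_euler_lift_lift T hY hΦZ p hg,
    coneConnection_euler_euler_lift T hZ p, coneConnection_euler_lift_euler T hY p,
    coneMetric_euler_lift, app, app, h.skew]
  ring

end ConeEndo

/-! ### Type of the torsion form on the cone. -/

section ConeThreeForm

variable {E : Type*} [NormedAddCommGroup E] [NormedSpace ℝ E]
  {M : Type*} [TopologicalSpace M] [ChartedSpace E M] [IsManifold 𝓘(ℝ, E) ∞ M]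

/-- The 3-form `r² T` on the cone has no component of type `(3,0) + (0,3)`. -/
theorem SasakiEquations.coneThreeForm_coneEndo {g : BilinField 𝓘(ℝ, E) M}
    {ξ : VField 𝓘(ℝ, E) M} {η : OneForm 𝓘(ℝ, E) M} {Φ : EndoField 𝓘(ℝ, E) M}
    {T : ThreeForm 𝓘(ℝ, E) M} (s : SasakiEquations g ξ η Φ T) (p : Cone M)
    (u v w : TangentSpace (𝓘(ℝ, E).prod 𝓘(ℝ, ℝ)) p) :
    coneThreeForm T p ![u, v, w]
      = coneThreeForm T p ![coneEndo ξ η Φ p u, coneEndo ξ η Φ p v, w]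
        + coneThreeForm T p ![u, coneEndo ξ η Φ p v, coneEndo ξ η Φ p w]
        + coneThreeForm T p ![coneEndo ξ η Φ p u, v, coneEndo ξ η Φ p w] := by
  have t := s.torsion_xi s.torsion p.1
  simp only [coneThreeForm_apply, coneProj_coneEndo, T.add₁, T.add₂, T.add₃, T.smul₁, T.smul₂,
    T.smul₃, T.self₁₂, T.self₁₃, T.self₂₃]
  rw [s.torsion p.1 (coneProj p u)]
  have t₁ := t (coneProj p v) (coneProj p w)
  have t₂ := t (coneProj p u) (coneProj p w)
  have t₃ := t (coneProj p u) (coneProj p v)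
  rw [T.swap₁₂ p.1 (Φ p.1 (coneProj p u)) (ξ p.1), T.swap₁₂ p.1 (coneProj p u) (ξ p.1),
    T.swap₂₃ p.1 (coneProj p u) (Φ p.1 (coneProj p v)) (ξ p.1),
    T.swap₁₂ p.1 (coneProj p u) (ξ p.1),
    T.swap₂₃ p.1 (Φ p.1 (coneProj p u)) (coneProj p v) (ξ p.1),
    T.swap₁₂ p.1 (Φ p.1 (coneProj p u)) (ξ p.1)]
  -- `J` adds to each projected vector `dr/r` times `ξ`. Terms with `ξ` twice vanish; those with `ξ`
  -- once pair up according to the argument that produced `ξ`, and each pair vanishes by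
  -- `torsion_xi`.
  linear_combination (p.2 : ℝ) ^ 2 * (-((p.2 : ℝ)⁻¹ * coneDr p u) * t₁
    + (p.2 : ℝ)⁻¹ * coneDr p v * t₂ - (p.2 : ℝ)⁻¹ * coneDr p w * t₃)

end ConeThreeForm

/-! ### The Sasaki equations are equivalent to the Kähler with torsion condition for `coneEndo`. -/

section ConeSasaki

variable {E : Type*} [NormedAddCommGroup E] [NormedSpace ℝ E] [FiniteDimensional ℝ E]
  {M : Type*} [TopologicalSpace M] [T2Space M] [ChartedSpace E M] [IsManifold 𝓘(ℝ, E) ∞ M]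

/-- A tensorial operation on the cone vanishing on lifts and on `r ∂_r` vanishes. -/
theorem cone_tensorial_eq_zero {F : VField (𝓘(ℝ, E).prod 𝓘(ℝ, ℝ)) (Cone M) → ℝ} {p : Cone M}
    (hF : TensorialAt (𝓘(ℝ, E).prod 𝓘(ℝ, ℝ)) (E × ℝ) F p)
    (hlift : ∀ X : VField 𝓘(ℝ, E) M, SmoothVF X → F (coneLift X) = 0) (heuler : F coneEuler = 0)
    {V : VField (𝓘(ℝ, E).prod 𝓘(ℝ, ℝ)) (Cone M)} (hV : DiffVF V p) : F V = 0 := by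
  have hr : (p.2 : ℝ) ≠ 0 := ne_of_gt p.2.2
  obtain ⟨X, hX, hXp⟩ := exists_smoothVF_eq p.1 (coneProj p (V p))
  have hR := (smoothVF_coneEuler (E := E) (M := M)).diffVF p
  -- By tensoriality only the value of `V` at `p` matters, so the coefficient of `r ∂_r` may be
  -- frozen to a constant.
  have hc : MDifferentiableAt (𝓘(ℝ, E).prod 𝓘(ℝ, ℝ)) 𝓘(ℝ, ℝ)
    (fun _ : Cone M => coneDr p (V p) / p.2) p := mdifferentiableAt_const
  have e : V p = coneLift X p + (coneDr p (V p) / p.2) • coneEuler p := by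
    apply cone_ext
    · rw [map_add, map_smul, coneProj_lift, coneProj_euler, hXp,
        smul_zero, add_zero]
    · rw [map_add, map_smul, coneDr_lift, coneDr_euler, zero_add, smul_eq_mul,
        div_mul_cancel₀ _ hr]
  rw [hF.pointwise hV (DiffVF.add (hX.coneLift.diffVF p) (hR.smul hc)) e,
    hF.add (hX.coneLift.diffVF p) (hR.smul hc), hF.smul hc hR, hlift X hX, heuler, smul_zero,
    add_zero]

variable {g : BilinField 𝓘(ℝ, E) M} {ξ : VField 𝓘(ℝ, E) M} {η : OneForm 𝓘(ℝ, E) M}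
  {Φ : EndoField 𝓘(ℝ, E) M} {T : ThreeForm 𝓘(ℝ, E) M} (hg : IsDiffMetric g)
  (hG : IsDiffMetric (coneMetric g))
include hg hG

theorem SasakiEquations.endoDeriv_coneEndo (s : SasakiEquations g ξ η Φ T)
    {U V W : VField (𝓘(ℝ, E).prod 𝓘(ℝ, ℝ)) (Cone M)} {p : Cone M} (hU : DiffVF U p)
    (hV : DiffVF V p) (hW : DiffVF W p) :
    endoDeriv (coneMetric g) (coneThreeForm T) (coneEndo ξ η Φ) U V W p = 0 := by
  have : CompleteSpace E := FiniteDimensional.complete ℝ E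
  have h := s.toIsAlmostContactMetric
  have hJ := smoothEndo_coneEndo_of_isAlmostContactMetric h
  have swap := endoDeriv_swap hG (coneThreeForm T) (coneEndo_skew h hg)
  have hR := fun p => (smoothVF_coneEuler (E := E) (M := M)).diffVF p
  have RR : ∀ V, endoDeriv (coneMetric g) (coneThreeForm T) (coneEndo ξ η Φ) V coneEuler coneEuler p
      = 0 := fun V => self_eq_neg.1 (swap V coneEuler coneEuler p)
  have LLR : ∀ X Y : VField 𝓘(ℝ, E) M, SmoothVF X → SmoothVF Y → endoDeriv (coneMetric g)
      (coneThreeForm T) (coneEndo ξ η Φ) (coneLift X) (coneLift Y) coneEuler p = 0 :=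
    fun X Y hX hY => by
      rw [endoDeriv_coneEndo_lift_lift_euler h hG T hX hY p hg, s.deriv_xi X Y hX hY]; ring
  have LLL : ∀ X Y Z : VField 𝓘(ℝ, E) M, SmoothVF X → SmoothVF Y → SmoothVF Z →
      endoDeriv (coneMetric g) (coneThreeForm T) (coneEndo ξ η Φ) (coneLift X) (coneLift Y)
        (coneLift Z) p = 0 := fun X Y Z hX hY hZ => by
    rw [endoDeriv_coneEndo_lift_lift_lift h hG T hX hY hZ p hg, s.deriv_phi X Y Z hX hY hZ]; ring
  refine cone_tensorial_eq_zero (endoDeriv_tensorial₁ hG _ hJ hV hW) (fun X hX => ?_) ?_ hU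
  · refine cone_tensorial_eq_zero (endoDeriv_tensorial₃ hG _ hJ (hX.coneLift.diffVF p) hV)
      (fun Z hZ => ?_) ?_ hW
    · rw [swap, neg_eq_zero]
      exact cone_tensorial_eq_zero (endoDeriv_tensorial₃ hG _ hJ (hX.coneLift.diffVF p)
        (hZ.coneLift.diffVF p)) (fun Y hY => LLL X Z Y hX hZ hY) (LLR X Z hX hZ) hV
    · rw [swap, neg_eq_zero]
      refine cone_tensorial_eq_zero (endoDeriv_tensorial₃ hG _ hJ (hX.coneLift.diffVF p) (hR p))
        (fun Y hY => ?_) (RR _) hV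
      rw [swap, LLR X Y hX hY, neg_zero]
  · refine cone_tensorial_eq_zero (endoDeriv_tensorial₃ hG _ hJ (hR p) hV)
      (fun Z hZ => ?_) ?_ hW
    · rw [swap, neg_eq_zero]
      exact cone_tensorial_eq_zero (endoDeriv_tensorial₃ hG _ hJ (hR p)
        (hZ.coneLift.diffVF p)) (fun Y hY => endoDeriv_coneEndo_euler_lift_lift h hG T hZ hY p hg)
        (endoDeriv_coneEndo_euler_lift_euler h hG T hZ p hg) hV
    · rw [swap, neg_eq_zero]
      refine cone_tensorial_eq_zero (endoDeriv_tensorial₃ hG _ hJ (hR p) (hR p))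
        (fun Y hY => ?_) (RR _) hV
      rw [swap, endoDeriv_coneEndo_euler_lift_euler h hG T hY p hg, neg_zero]

theorem SasakiEquations.isKahlerWithTorsion (s : SasakiEquations g ξ η Φ T) :
    IsKahlerWithTorsion (coneMetric g) (coneEndo ξ η Φ) (coneThreeForm T) where
  hermitian :=
    { smooth := smoothEndo_coneEndo_of_isAlmostContactMetric s.toIsAlmostContactMetric
      sq := coneEndo_sq s.toIsAlmostContactMetric
      isometric := coneEndo_isometric s.toIsAlmostContactMetric hg
      nijenhuis := fun X Y hX hY p => by
        have h := s.toIsAlmostContactMetric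
        have hJ := smoothEndo_coneEndo_of_isAlmostContactMetric h
        have hJJ : ∀ V : VField (𝓘(ℝ, E).prod 𝓘(ℝ, ℝ)) (Cone M),
            app (coneEndo ξ η Φ) (app (coneEndo ξ η Φ) V) = -V :=
          fun V => funext fun q => coneEndo_sq h q (V q)
        refine hG.nondeg p _ fun w => ?_
        obtain ⟨Z, hZ, rfl⟩ := exists_smoothVF_eq p w
        have hX' := hX.diffVF p
        have hY' := hY.diffVF p
        have hZ' := hZ.diffVF p
        rw [sub_sub, ← map_add, nijenhuis_eq hG (coneThreeForm T) (coneEndo_skew h hg) hX' hY' hZ'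
          (hJJ X) (hJJ Y), s.endoDeriv_coneEndo hg hG (hJ.diffVF_app hX') hY' hZ',
          s.endoDeriv_coneEndo hg hG (hJ.diffVF_app hY') hX' hZ',
          s.endoDeriv_coneEndo hg hG hX' (hJ.diffVF_app hY') hZ',
          s.endoDeriv_coneEndo hg hG hY' (hJ.diffVF_app hX') hZ',
          s.coneThreeForm_coneEndo p (X p) (Y p)]
        simp only [app]
        ring }
  parallel X Y Z hX hY hZ p := eq_neg_of_add_eq_zero_left
    (s.endoDeriv_coneEndo hg hG (hX.diffVF p) (hY.diffVF p) (hZ.diffVF p))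

theorem IsAlmostContactMetric.sasakiEquations_of_isKahlerWithTorsion
    (h : IsAlmostContactMetric g ξ η Φ)
    (k : IsKahlerWithTorsion (coneMetric g) (coneEndo ξ η Φ) (coneThreeForm T)) :
    SasakiEquations g ξ η Φ T := by
  have : CompleteSpace E := FiniteDimensional.complete ℝ E
  have hJ := smoothEndo_coneEndo_of_isAlmostContactMetric h
  have hR := smoothVF_coneEuler (E := E) (M := M)
  have h₁ : (posOne : ℝ) = 1 := rfl
  have P : ∀ {U V W : VField (𝓘(ℝ, E).prod 𝓘(ℝ, ℝ)) (Cone M)}, SmoothVF U → SmoothVF V →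
      SmoothVF W → ∀ p, endoDeriv (coneMetric g) (coneThreeForm T) (coneEndo ξ η Φ) U V W p = 0 :=
    fun hU hV hW p => by rw [endoDeriv, k.parallel _ _ _ hU hV hW, neg_add_cancel]
  refine { toIsAlmostContactMetric := h, deriv_xi := ?_, deriv_phi := ?_, torsion := ?_ }
  · intro X Y hX hY x
    have e := P hX.coneLift hY.coneLift hR (x, posOne)
    rw [endoDeriv_coneEndo_lift_lift_euler h hG T hX hY _ hg, h₁] at e
    linarith
  · intro X Y Z hX hY hZ x
    have e := P hX.coneLift hY.coneLift hZ.coneLift (x, posOne)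
    rw [endoDeriv_coneEndo_lift_lift_lift h hG T hX hY hZ _ hg, h₁] at e
    linarith
  · intro x u v w
    obtain ⟨X, hX, rfl⟩ := exists_smoothVF_eq x u
    obtain ⟨Y, hY, rfl⟩ := exists_smoothVF_eq x v
    obtain ⟨Z, hZ, rfl⟩ := exists_smoothVF_eq x w
    have hX' := hX.coneLift
    have hY' := hY.coneLift
    have hZ' := hZ.coneLift
    have hJJ : ∀ V : VField (𝓘(ℝ, E).prod 𝓘(ℝ, ℝ)) (Cone M),
        app (coneEndo ξ η Φ) (app (coneEndo ξ η Φ) V) = -V :=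
      fun V => funext fun q => coneEndo_sq h q (V q)
    -- With `J` parallel and integrable, `nijenhuis_eq` leaves only the torsion terms. On lifts,
    -- `JX` projects to `ΦX`, which gives the condition on `T`.
    have key : ∀ p : Cone M, (p.2 : ℝ) ^ 2 * (T p.1 ![X p.1, Y p.1, Z p.1]
        - (T p.1 ![X p.1, Φ p.1 (Y p.1), Φ p.1 (Z p.1)]
          + T p.1 ![Φ p.1 (X p.1), Y p.1, Φ p.1 (Z p.1)]
          + T p.1 ![Φ p.1 (X p.1), Φ p.1 (Y p.1), Z p.1])) = 0 := by
      intro p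
      have n := nijenhuis_eq hG (coneThreeForm T) (coneEndo_skew h hg) (hX'.diffVF p)
        (hY'.diffVF p) (hZ'.diffVF p) (hJJ _) (hJJ _)
      rw [map_add, ← sub_sub, k.hermitian.nijenhuis _ _ hX' hY', map_zero, zero_apply,
        P (hJ.smoothVF_app hX') hY' hZ', P (hJ.smoothVF_app hY') hX' hZ',
        P hX' (hJ.smoothVF_app hY') hZ', P hY' (hJ.smoothVF_app hX') hZ'] at n
      simp only [app, coneThreeForm_apply, coneProj_coneEndo, coneProj_lift, coneDr_lift, mul_zero,
        zero_smul, add_zero] at n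
      linarith
    have e := key (x, posOne)
    rw [h₁, one_pow, one_mul] at e
    exact sub_eq_zero.1 e

end ConeSasaki

/-! ### Homogeneous functions along the rays. -/

section Rays

variable {E : Type*} [NormedAddCommGroup E] [NormedSpace ℝ E]
  {M : Type*} [TopologicalSpace M] [ChartedSpace E M]

/-- The ray through `x`, in its exponential parametrisation. -/
def coneRay (x : M) (s : ℝ) : Cone M := (x, ⟨Real.exp s, Real.exp_pos s⟩)

theorem mdifferentiableAt_coneRay (x : M) (s : ℝ) :
    MDifferentiableAt 𝓘(ℝ, ℝ) (𝓘(ℝ, E).prod 𝓘(ℝ, ℝ)) (coneRay x) s := by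
  have h : ContMDiff 𝓘(ℝ, ℝ) 𝓘(ℝ, ℝ) ∞
      (fun s : ℝ => (⟨Real.exp s, Real.exp_pos s⟩ : PosReal)) :=
    (ContMDiff.subtypeVal_comp_iff PosReal _).1 Real.contDiff_exp.contMDiff
  exact mdifferentiableAt_const.prodMk (h.mdifferentiable (by simp) s)

/-- With `r = eˢ` the ray becomes an integral curve of `r ∂_r`, which turns Euler's equation into an
ordinary differential equation in `s`. -/
theorem mfderiv_coneRay (x : M) (s : ℝ) :
    mfderiv 𝓘(ℝ, ℝ) (𝓘(ℝ, E).prod 𝓘(ℝ, ℝ)) (coneRay x) s (1 : ℝ) = coneEuler (coneRay x s) := by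
  have hr : MDifferentiableAt (𝓘(ℝ, E).prod 𝓘(ℝ, ℝ)) 𝓘(ℝ, ℝ) (fun q : Cone M => (q.2 : ℝ))
      (coneRay x s) := contMDiff_coneRadius.mdifferentiable (n := ∞) (by simp) _
  apply cone_ext
  · have c := mfderiv_comp_apply s (mdifferentiableAt_fst (I := 𝓘(ℝ, E)) (I' := 𝓘(ℝ, ℝ)))
      (mdifferentiableAt_coneRay x s) (1 : ℝ)
    rw [coneProj_euler]
    refine c.symm.trans ?_
    rw [show (Prod.fst ∘ coneRay x : ℝ → M) = fun _ => x from rfl, mfderiv_const]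
    rfl
  · have c := mvfderiv_comp_apply s hr (mdifferentiableAt_coneRay x s) (1 : ℝ)
    rw [coneDr_euler]
    refine c.symm.trans ?_
    change mfderiv 𝓘(ℝ, ℝ) 𝓘(ℝ, ℝ) Real.exp s (1 : ℝ) = Real.exp s
    rw [mfderiv_eq_fderiv]
    change fderiv ℝ Real.exp s 1 = Real.exp s
    rw [(Real.hasDerivAt_exp s).hasFDerivAt.fderiv]
    simp

/-- A function on the cone with `r ∂_r f = 2 f` is homogeneous of degree two. -/
theorem eq_sq_mul_of_dirDeriv_euler {f : Cone M → ℝ}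
    (hf : ∀ p, MDifferentiableAt (𝓘(ℝ, E).prod 𝓘(ℝ, ℝ)) 𝓘(ℝ, ℝ) f p)
    (h : ∀ p, dirDeriv (coneEuler (E := E)) f p = 2 * f p) (p : Cone M) :
    f p = (p.2 : ℝ) ^ 2 * f (p.1, posOne) := by
  obtain ⟨x, r⟩ := p
  have hr : (0 : ℝ) < r := r.2
  have d : ∀ s, HasDerivAt (f ∘ coneRay x) (2 * f (coneRay x s)) s := by
    intro s
    have m := (hf (coneRay x s)).comp s (mdifferentiableAt_coneRay x s)
    have c := mvfderiv_comp_apply s (hf (coneRay x s)) (mdifferentiableAt_coneRay x s) (1 : ℝ)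
    rw [mfderiv_coneRay, show mvfderiv _ f (coneRay x s) (coneEuler (coneRay x s)) = _
      from h (coneRay x s)] at c
    rw [← c]
    change HasDerivAt _ (mfderiv 𝓘(ℝ, ℝ) 𝓘(ℝ, ℝ) (f ∘ coneRay x) s (1 : ℝ)) s
    rw [mfderiv_eq_fderiv]
    exact m.differentiableAt.hasFDerivAt.hasDerivAt
  -- The integrating factor `e⁻²ˢ` makes the function constant; comparing `s = log r` with `s = 0`
  -- gives the factor `r²`.
  have d' : ∀ s, HasDerivAt (fun s => f (coneRay x s) * Real.exp (-2 * s)) 0 s := by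
    intro s
    have e := (d s).mul (((hasDerivAt_id s).const_mul (-2)).exp)
    refine e.congr_deriv ?_
    simp only [Function.comp_apply, id]
    ring
  have c := is_const_of_deriv_eq_zero (fun s => (d' s).differentiableAt) (fun s => (d' s).deriv)
    (Real.log r) 0
  have e₁ : coneRay x (Real.log r) = (x, r) :=
    Prod.ext rfl (Subtype.ext (Real.exp_log hr))
  have e₀ : coneRay x 0 = (x, posOne) := Prod.ext rfl (Subtype.ext Real.exp_zero)
  have e₂ : Real.exp (-2 * Real.log r) = ((r : ℝ) ^ 2)⁻¹ := by
    rw [neg_mul, Real.exp_neg, show 2 * Real.log r = Real.log r + Real.log r by ring,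
      Real.exp_add, Real.exp_log hr, sq]
  simp only [e₁, e₀, e₂, mul_zero, Real.exp_zero, mul_one] at c
  rw [← c]
  field_simp

end Rays

/-! ### A parallel complex structure on the cone is determined by its triple. -/

section ConeComplexStructure

variable {E : Type*} [NormedAddCommGroup E] [NormedSpace ℝ E]
  {M : Type*} [TopologicalSpace M] [ChartedSpace E M]

theorem coneProj_radial (p : Cone M) : coneProj (E := E) p (coneRadial p) = 0 :=
  coneProj_apply p _

theorem coneDr_radial (p : Cone M) : coneDr (E := E) p (coneRadial p) = 1 :=
  coneDr_apply p _

theorem coneProj_incl (x : M) (v : TangentSpace 𝓘(ℝ, E) x) :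
    coneProj (x, posOne) (coneIncl x v) = v := by
  rw [coneProj_apply, coneIncl_apply]

theorem coneDr_incl (x : M) (v : TangentSpace 𝓘(ℝ, E) x) :
    coneDr (x, posOne) (coneIncl x v) = 0 := by
  rw [coneDr_apply, coneIncl_apply]

theorem coneIncl_eq_lift (X : VField 𝓘(ℝ, E) M) (x : M) :
    coneIncl x (X x) = coneLift X (x, posOne) :=
  coneIncl_apply x (X x)

theorem coneRadial_eq_euler (x : M) :
    coneRadial (E := E) (x, posOne) = coneEuler (x, posOne) := rfl

variable [IsManifold 𝓘(ℝ, E) ∞ M]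

theorem IsHermitian.skew {E : Type*} [NormedAddCommGroup E] [NormedSpace ℝ E]
    {H : Type*} [TopologicalSpace H] {I : ModelWithCorners ℝ E H}
    {N : Type*} [TopologicalSpace N] [ChartedSpace H N] [IsManifold I ∞ N]
    {g : BilinField I N} {J : EndoField I N} (h : IsHermitian g J) (x : N)
    (v w : TangentSpace I x) : g x (J x v) w = -g x v (J x w) := by
  rw [← h.isometric x v, h.sq, map_neg, neg_neg]

variable [FiniteDimensional ℝ E] [T2Space M] {g : BilinField 𝓘(ℝ, E) M}
  {T : ThreeForm 𝓘(ℝ, E) M} (hG : IsDiffMetric (coneMetric g))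
include hG

/-- The equation `∇ᵀ_R Y = Y` on the cone, where `R = r ∂_r`, can be tested on lifts and on `R`. -/
theorem coneConnection_euler_of_lift {Y W : VField (𝓘(ℝ, E).prod 𝓘(ℝ, ℝ)) (Cone M)} {p : Cone M}
    (hY : SmoothVF Y) (hlift : ∀ Z : VField 𝓘(ℝ, E) M, SmoothVF Z →
      torsionConnection (coneMetric g) (coneThreeForm T) coneEuler Y (coneLift Z) p
        = coneMetric g p (Y p) (coneLift Z p))
    (heuler : torsionConnection (coneMetric g) (coneThreeForm T) coneEuler Y coneEuler p
        = coneMetric g p (Y p) (coneEuler p)) (hW : DiffVF W p) :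
    torsionConnection (coneMetric g) (coneThreeForm T) coneEuler Y W p
      = coneMetric g p (Y p) (W p) := by
  have : CompleteSpace E := FiniteDimensional.complete ℝ E
  have hR := (smoothVF_coneEuler (E := E) (M := M)).diffVF p
  refine sub_eq_zero.1 (cone_tensorial_eq_zero (F := fun W => torsionConnection (coneMetric g)
    (coneThreeForm T) coneEuler Y W p - coneMetric g p (Y p) (W p)) ⟨fun hf hW => ?_,
      fun hW hW' => ?_⟩ (fun Z hZ => sub_eq_zero.2 (hlift Z hZ)) (sub_eq_zero.2 heuler) hW)
  · simp only [torsionConnection_smul₃ hG _ hf hR (hY.diffVF p) hW, Pi.smul_apply', map_smul,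
      smul_eq_mul]
    ring
  · simp only [torsionConnection_add₃ hG _ hR (hY.diffVF p) hW hW', Pi.add_apply, map_add]
    ring

variable (T) in
theorem coneConnection_euler_euler {W : VField (𝓘(ℝ, E).prod 𝓘(ℝ, ℝ)) (Cone M)} {p : Cone M}
    (hW : DiffVF W p) :
    torsionConnection (coneMetric g) (coneThreeForm T) coneEuler coneEuler W p
      = coneMetric g p (coneEuler p) (W p) := by
  have : CompleteSpace E := FiniteDimensional.complete ℝ E
  refine coneConnection_euler_of_lift hG smoothVF_coneEuler (fun Z hZ => ?_) ?_ hW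
  · rw [coneConnection_euler_euler_lift T hZ, coneMetric_euler_lift]
  · rw [coneConnection_euler_euler_euler, coneMetric_euler_euler, mul_one]

variable (hg : IsDiffMetric g)
include hg

variable (T) in
theorem coneConnection_euler_lift {Y : VField 𝓘(ℝ, E) M} (hY : SmoothVF Y)
    {W : VField (𝓘(ℝ, E).prod 𝓘(ℝ, ℝ)) (Cone M)} {p : Cone M} (hW : DiffVF W p) :
    torsionConnection (coneMetric g) (coneThreeForm T) coneEuler (coneLift Y) W p
      = coneMetric g p (coneLift Y p) (W p) := by
  have : CompleteSpace E := FiniteDimensional.complete ℝ E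
  refine coneConnection_euler_of_lift hG hY.coneLift (fun Z hZ => ?_) ?_ hW
  · rw [coneConnection_euler_lift_lift T hY hZ p hg, coneMetric_lift_lift]
  · rw [coneConnection_euler_lift_euler T hY, coneMetric_lift_euler]

variable {J : EndoField (𝓘(ℝ, E).prod 𝓘(ℝ, ℝ)) (Cone M)}
  (k : IsKahlerWithTorsion (coneMetric g) J (coneThreeForm T))
include k

/-- The function `ḡ(J Y, Z)` is homogeneous of degree two for `∇ᵀ_R Y = Y` and `Z` a lift. -/
theorem IsKahlerWithTorsion.homogeneous {Y : VField (𝓘(ℝ, E).prod 𝓘(ℝ, ℝ)) (Cone M)}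
    (hY : SmoothVF Y) (hRY : ∀ W p, SmoothVF W →
      torsionConnection (coneMetric g) (coneThreeForm T) coneEuler Y W p
        = coneMetric g p (Y p) (W p))
    {Z : VField 𝓘(ℝ, E) M} (hZ : SmoothVF Z) (p : Cone M) :
    coneMetric g p (J p (Y p)) (coneLift Z p) = (p.2 : ℝ) ^ 2
      * coneMetric g (p.1, posOne) (J (p.1, posOne) (Y (p.1, posOne)))
        (coneLift Z (p.1, posOne)) := by
  have hJ := k.hermitian.smooth
  refine eq_sq_mul_of_dirDeriv_euler (f := fun p => coneMetric g p (J p (Y p)) (coneLift Z p))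
    (fun q => hG.diff (hJ.diffVF_app (hY.diffVF q)) (hZ.coneLift.diffVF q)) (fun q => ?_) p
  -- Both `∇̄_R(JY) = JY` (from `∇̄J = 0`) and `∇̄_R Z = Z` contribute one copy of `ḡ(JY, Z)`,
  -- whence degree two.
  have m := torsionConnection_metric hG (coneThreeForm T) coneEuler (app J Y) (coneLift Z) q
  rw [k.parallel _ _ _ smoothVF_coneEuler hY hZ.coneLift,
    hRY _ q (hJ.smoothVF_app hZ.coneLift),
    coneConnection_euler_lift T hG hg hZ ((hJ.smoothVF_app hY).diffVF q)] at m
  refine m.symm.trans ?_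
  rw [hG.symm q (coneLift Z q)]
  simp only [app]
  rw [k.hermitian.skew q (Y q)]
  ring

variable {ξ : VField 𝓘(ℝ, E) M} {η : OneForm 𝓘(ℝ, E) M} {Φ : EndoField 𝓘(ℝ, E) M}
  (hξ : ∀ x : M, ξ x = coneProj (x, posOne) (J (x, posOne) (coneRadial (x, posOne))))
  (hη : ∀ (x : M) (v : TangentSpace 𝓘(ℝ, E) x), η x v = g x (ξ x) v)
  (hΦ : ∀ (x : M) (v : TangentSpace 𝓘(ℝ, E) x),
    Φ x v = coneProj (x, posOne) (J (x, posOne) (coneIncl x v)))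

/-- The cone metric against a lift carries its own factor `r²`; it cancels the homogeneity factor,
so the horizontal part of `JY` is constant along rays. -/
theorem IsKahlerWithTorsion.coneProj_eq {Y : VField (𝓘(ℝ, E).prod 𝓘(ℝ, ℝ)) (Cone M)}
    (hY : SmoothVF Y) (hRY : ∀ W p, SmoothVF W →
      torsionConnection (coneMetric g) (coneThreeForm T) coneEuler Y W p
        = coneMetric g p (Y p) (W p)) (p : Cone M) :
    coneProj p (J p (Y p)) = coneProj (p.1, posOne) (J (p.1, posOne) (Y (p.1, posOne))) := by
  have hr : (p.2 : ℝ) ^ 2 ≠ 0 := pow_ne_zero 2 (ne_of_gt p.2.2)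
  refine sub_eq_zero.1 (hg.nondeg p.1 _ fun w => ?_)
  obtain ⟨Z, hZ, rfl⟩ := exists_smoothVF_eq p.1 w
  have e := k.homogeneous hG hg hY hRY hZ p
  have f : ∀ q : Cone M, ∀ v, coneMetric g q v (coneLift Z q)
      = (q.2 : ℝ) ^ 2 * g q.1 (coneProj q v) (Z q.1) := fun q v => by
    rw [coneMetric_apply, coneDr_lift, coneProj_lift, mul_zero, zero_add]
  rw [f, f] at e
  have e' := mul_left_cancel₀ hr e
  rw [map_sub]
  refine sub_eq_zero.2 (e'.trans ?_)
  exact (congrArg (· * _) (one_pow 2)).trans (one_mul _)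

include hξ hη hΦ

/-- Horizontal components are carried from `r = 1` along the rays by `coneProj_eq`. Radial ones
follow from skewness: `ḡ(JR,R) = 0`, and `ḡ(Jv,R) = -ḡ(v,JR)` expresses the radial part of `Jv`
through `η`. -/
theorem IsKahlerWithTorsion.eq_coneEndo : J = coneEndo ξ η Φ := by
  have pL : ∀ X : VField 𝓘(ℝ, E) M, SmoothVF X → ∀ p : Cone M,
      coneProj p (J p (coneLift X p)) = Φ p.1 (X p.1) := fun X hX p => by
    rw [k.coneProj_eq hG hg hX.coneLift (fun W p hW =>
      coneConnection_euler_lift T hG hg hX (hW.diffVF p)), hΦ, coneIncl_eq_lift]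
  have pR : ∀ p : Cone M, coneProj p (J p (coneEuler p)) = ξ p.1 := fun p => by
    rw [k.coneProj_eq hG hg smoothVF_coneEuler (fun W p hW =>
      coneConnection_euler_euler T hG (hW.diffVF p)), hξ, coneRadial_eq_euler]
  funext p
  ext1 v
  have hr : (p.2 : ℝ) ≠ 0 := ne_of_gt p.2.2
  have f : ∀ v, coneMetric g p v (coneEuler p) = coneDr p v * p.2 := fun v => by
    rw [coneMetric_apply, coneDr_euler, coneProj_euler, map_zero, mul_zero, add_zero]
  have dR : coneDr p (J p (coneEuler p)) = 0 := by
    have e := k.hermitian.skew p (coneEuler p) (coneEuler p)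
    rw [hG.symm p (coneEuler p), f] at e
    exact (mul_eq_zero.1 (self_eq_neg.1 e)).resolve_right hr
  apply cone_ext
  · obtain ⟨X, hX, hXp⟩ := exists_smoothVF_eq p.1 (coneProj p v)
    have e : v = coneLift X p + ((p.2 : ℝ)⁻¹ * coneDr p v) • coneEuler p := by
      apply cone_ext
      · rw [map_add, map_smul, coneProj_lift, coneProj_euler, hXp, smul_zero, add_zero]
      · rw [map_add, map_smul, coneDr_lift, coneDr_euler, zero_add, smul_eq_mul, mul_right_comm,
          inv_mul_cancel₀ hr, one_mul]
    rw [coneProj_coneEndo, ← hXp, ← pL X hX, ← pR, ← map_smul, ← map_smul, ← map_add, ← map_add,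
      ← e]
  · have e := k.hermitian.skew p v (coneEuler p)
    rw [f, coneMetric_apply, dR, pR, hg.symm, ← hη] at e
    rw [coneDr_coneEndo]
    refine mul_right_cancel₀ hr (e.trans ?_)
    ring

end ConeComplexStructure

/-! ### Triples associated with a complex structure on the cone. -/

section AssociatedTriple

variable {E : Type*} [NormedAddCommGroup E] [NormedSpace ℝ E]
  {M : Type*} [TopologicalSpace M] [ChartedSpace E M] [IsManifold 𝓘(ℝ, E) ∞ M]
  {g : Bundle.ContMDiffRiemannianMetric 𝓘(ℝ, E) ∞ E (fun x : M => TangentSpace 𝓘(ℝ, E) x)}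
  {T : ThreeForm 𝓘(ℝ, E) M} {ξ : VField 𝓘(ℝ, E) M} {η : OneForm 𝓘(ℝ, E) M}
  {Φ : EndoField 𝓘(ℝ, E) M}

theorem smoothVF_coneTriple {J : EndoField (𝓘(ℝ, E).prod 𝓘(ℝ, ℝ)) (Cone M)} (hJ : SmoothEndo J)
    (hξ : ∀ x : M, ξ x = coneProj (x, posOne) (J (x, posOne) (coneRadial (x, posOne)))) :
    SmoothVF ξ := by
  have h₁ := hJ.smoothVF_app (smoothVF_coneEuler (E := E) (M := M))
  have h₂ : ContMDiff 𝓘(ℝ, E) (𝓘(ℝ, E).prod 𝓘(ℝ, ℝ)) ∞ (fun x : M => ((x, posOne) : Cone M)) :=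
    contMDiff_id.prodMk contMDiff_const
  refine (contMDiff_coneProj.comp (ContMDiff.comp h₁ h₂)).congr fun x => ?_
  rw [hξ]
  rfl

theorem smoothEndo_coneTriple {J : EndoField (𝓘(ℝ, E).prod 𝓘(ℝ, ℝ)) (Cone M)} (hJ : SmoothEndo J)
    (hΦ : ∀ (x : M) (v : TangentSpace 𝓘(ℝ, E) x),
      Φ x v = coneProj (x, posOne) (J (x, posOne) (coneIncl x v))) : SmoothEndo Φ := by
  refine (contMDiff_coneProj.comp (ContMDiff.comp hJ contMDiff_coneIncl)).congr fun v => ?_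
  rw [hΦ]
  rfl

theorem smoothOneForm_dual (hξ : SmoothVF ξ)
    (hη : ∀ (x : M) (v : TangentSpace 𝓘(ℝ, E) x), η x v = g.inner x (ξ x) v) :
    SmoothOneForm η := by
  refine (contMDiff_metric_apply g (b := fun v : TangentBundle 𝓘(ℝ, E) M => v.1)
    (v := fun v => ξ v.1) (w := fun v => v.2) ?_ contMDiff_id).congr fun v => hη v.1 v.2
  exact ContMDiff.comp (show ContMDiff _ _ _ _ from hξ)
    (Bundle.contMDiff_proj (TangentSpace 𝓘(ℝ, E)))

variable [FiniteDimensional ℝ E] [T2Space M]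

/-- The radial part of `J²R = -R` gives `η(ξ) = 1`, the horizontal part of `J²` on lifts gives the
formula for `Φ²`, and `J`-invariance of the cone metric on lifts gives the metric identity. -/
theorem isAlmostContactMetric_of_coneEndo (hξ : SmoothVF ξ) (hη : SmoothOneForm η)
    (hΦ : SmoothEndo Φ) (h : IsHermitian (coneMetric g.inner) (coneEndo ξ η Φ)) :
    IsAlmostContactMetric g.inner ξ η Φ := by
  have key : ∀ p : Cone M, η p.1 (ξ p.1) = 1
      ∧ (∀ v, Φ p.1 (Φ p.1 v) = -v + η p.1 v • ξ p.1)
      ∧ ∀ v w, g.inner p.1 (Φ p.1 v) (Φ p.1 w) = g.inner p.1 v w - η p.1 v * η p.1 w := by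
    intro p
    have hr : (p.2 : ℝ) ≠ 0 := ne_of_gt p.2.2
    refine ⟨?_, fun v => ?_, fun v w => ?_⟩
    · have e := congrArg (coneDr p) (h.sq p (coneEuler p))
      rw [coneDr_coneEndo, coneProj_coneEndo, coneProj_euler, coneDr_euler, map_zero, zero_add,
        inv_mul_cancel₀ hr, one_smul, map_neg, coneDr_euler, neg_inj] at e
      exact mul_left_cancel₀ hr (e.trans (mul_one _).symm)
    · obtain ⟨X, -, rfl⟩ := exists_smoothVF_eq p.1 v
      have e := congrArg (coneProj p) (h.sq p (coneLift X p))
      rw [coneProj_coneEndo, coneProj_coneEndo, coneDr_coneEndo, coneProj_lift, coneDr_lift,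
        mul_zero, zero_smul, add_zero, map_neg, coneProj_lift, mul_neg, inv_mul_cancel_left₀ hr,
        neg_smul, ← sub_eq_add_neg, sub_eq_iff_eq_add] at e
      exact e
    · obtain ⟨X, -, rfl⟩ := exists_smoothVF_eq p.1 v
      obtain ⟨Y, -, rfl⟩ := exists_smoothVF_eq p.1 w
      have e := h.isometric p (coneLift X p) (coneLift Y p)
      rw [coneMetric_lift_lift, coneMetric_apply, coneDr_coneEndo, coneDr_coneEndo,
        coneProj_coneEndo, coneProj_coneEndo, coneProj_lift, coneProj_lift, coneDr_lift,
        coneDr_lift, mul_zero, zero_smul, add_zero, add_zero] at e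
      refine mul_left_cancel₀ (pow_ne_zero 2 hr) ?_
      linarith
  exact
    { smooth_xi := hξ
      smooth_eta := hη
      smooth_phi := hΦ
      eta_xi := fun x => (key (x, posOne)).1
      phi_sq := fun x => (key (x, posOne)).2.1
      metric := fun x => (key (x, posOne)).2.2 }

/-- The triples associated with a Sasaki with torsion structure are the solutions of the
equations `∇ᵀ ξ = Φ`, `(∇ᵀ_X Φ) Y = η(Y) X - g(X, Y) ξ`. -/
theorem isSTTriple_iff_sasakiEquations :
    IsSTTriple g.inner T ξ η Φ ↔ SasakiEquations g.inner ξ η Φ T := by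
  have hg := isDiffMetric_riemannian g
  have hG := isDiffMetric_cone g
  constructor
  · rintro ⟨J, k, hξ, hη, hΦ⟩
    have hJ := k.hermitian.smooth
    have sξ := smoothVF_coneTriple hJ hξ
    have e := k.eq_coneEndo hG hg hξ hη hΦ
    have k' := k
    rw [e] at k'
    exact (isAlmostContactMetric_of_coneEndo sξ (smoothOneForm_dual sξ hη)
      (smoothEndo_coneTriple hJ hΦ) k'.hermitian).sasakiEquations_of_isKahlerWithTorsion hg hG k'
  · intro s
    refine ⟨coneEndo ξ η Φ, s.isKahlerWithTorsion hg hG, fun x => ?_,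
      fun x v => (s.eta_eq x v).symm, fun x v => ?_⟩
    · refine Eq.symm ((coneProj_coneEndo ξ η Φ (x, posOne) _).trans ?_)
      rw [coneProj_radial, coneDr_radial, map_zero, zero_add, mul_one]
      exact (congrArg (· • ξ x) inv_one).trans (one_smul ℝ (ξ x))
    · refine Eq.symm ((coneProj_coneEndo ξ η Φ (x, posOne) _).trans ?_)
      rw [coneDr_incl, mul_zero, zero_smul, add_zero]
      exact congrArg (Φ x) (coneProj_incl x v)

end AssociatedTriple

end STGeometry

end

open STGeometry in
theorem proposition2p5 {E : Type*} [NormedAddCommGroup E] [NormedSpace ℝ E] [FiniteDimensional ℝ E]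
    {M : Type*} [TopologicalSpace M] [T2Space M] [ChartedSpace E M] [IsManifold 𝓘(ℝ, E) ∞ M]
    (g : Bundle.ContMDiffRiemannianMetric 𝓘(ℝ, E) ∞ E (fun x : M => TangentSpace 𝓘(ℝ, E) x))
    (T : ThreeForm 𝓘(ℝ, E) M) (hT : SmoothThreeForm T) :
    (IsSasakiWithTorsion g.inner T ↔
      ∃ (ξ : VField 𝓘(ℝ, E) M) (η : OneForm 𝓘(ℝ, E) M) (Φ : EndoField 𝓘(ℝ, E) M),
        IsTKContactMetric g.inner ξ η Φ T ∧
        IsIntegrableCR (contactDistribution η) Φ ∧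
        IsBismutOn g.inner (contactDistribution η) Φ T) ∧
    (∀ (ξ : VField 𝓘(ℝ, E) M) (η : OneForm 𝓘(ℝ, E) M) (Φ : EndoField 𝓘(ℝ, E) M),
      IsSTTriple g.inner T ξ η Φ ↔
        IsTKContactMetric g.inner ξ η Φ T ∧
        IsIntegrableCR (contactDistribution η) Φ ∧
        IsBismutOn g.inner (contactDistribution η) Φ T) := by
  have key : ∀ (ξ : VField 𝓘(ℝ, E) M) (η : OneForm 𝓘(ℝ, E) M) (Φ : EndoField 𝓘(ℝ, E) M),
      IsSTTriple g.inner T ξ η Φ ↔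
        IsTKContactMetric g.inner ξ η Φ T ∧ IsIntegrableCR (contactDistribution η) Φ ∧
          IsBismutOn g.inner (contactDistribution η) Φ T := fun ξ η Φ =>
    isSTTriple_iff_sasakiEquations.trans (sasakiEquations_iff (isDiffMetric_riemannian g))
  refine ⟨⟨?_, ?_⟩, key⟩
  · rintro ⟨J, k⟩
    -- Every `J` has an associated triple, given by the defining formulas, so the existence
    -- statement follows from the equivalence for triples.
    let ξ : VField 𝓘(ℝ, E) M := fun x =>
      coneProj (x, posOne) (J (x, posOne) (coneRadial (x, posOne)))
    exact ⟨ξ, fun x => g.inner x (ξ x),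
      fun x => (coneProj (x, posOne)).comp ((J (x, posOne)).comp (coneIncl x)),
      (key _ _ _).1 ⟨J, k, fun _ => rfl, fun _ _ => rfl, fun _ _ => rfl⟩⟩
  · rintro ⟨ξ, η, Φ, h⟩
    obtain ⟨J, k, -⟩ := (key ξ η Φ).2 h
    exact ⟨J, k⟩
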